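/- Let $\phi,\rho\in\mathbb R$ with $|\phi|<1$, $|\rho|<1$, and let $\sigma_\xi>0$. Let $(Y_t)_{t\ge 0}$ and $(\xi_t)_{t\ge 1}$ be real random variables on a probability space such that $Y_0=0$ a.s., $$Y_t=\phi Y_{t-1}+\xi_t\quad\text{a.s.},\qquad \xi_t\sim N(0,\sigma_\xi^2)\ (\text{variance } \sigma_\xi^2),\qquad t\ge 1,$$ and such that, for every $t\ge1$, the vector $(\xi_t,Y_{t-1})$ has the Gaussian copula $C_\rho$ with parameter $\rho$; that is, $\mathbb P(\xi_t\le x,\,Y_{t-1}\le y)=C_\rho\big(\mathbb P(\xi_t\le x),\mathbb P(Y_{t-1}\le y)\big)$ for all $x,y\in\mathbb R$, where $C_\rho$ is the joint distribution function of $(\Phi(A),\Phi(B))$, with $(A,B)$ bivariate Gaussian with standard normal margins and correlation $\rho$, and $\Phi$ the standard normal distribution function. Assume moreover that $(Y_t)_t$ is a Markov process with respect to its natural filtration. Let $V_t=\sqrt{\operatorname{Var}(Y_t)}$ and $$\bar V(\rho,\phi)=\frac{\sigma_\xi\left(\rho\phi+\sqrt{\rho^2\phi^2+1-\phi^2}\right)}{1-\phi^2}.$$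 For the sample $(Y_1,\dots,Y_T)$, let $\hat\phi_T$ be the OLS estimator of $\phi$ and $\tilde\phi_T$ the infeasible estimator, $$\hat\phi_T=\frac{\sum_{t=2}^T Y_tY_{t-1}}{\sum_{t=2}^T Y_{t-1}^2},\qquad \tilde\phi_T=\hat\phi_T-\rho\,\sigma_\xi\,\frac{\sum_{t=2}^T Y_{t-1}^2/V_{t-1}}{\sum_{t=2}^T Y_{t-1}^2}.$$ Then, as $T\to\infty$, $\sqrt T\,(\tilde\phi_T-\phi)$ converges in distribution to a centred normal random variable with standard deviation $$\bar\eta=\frac{\sigma_\xi\sqrt{1-\rho^2}}{\bar V(\rho,\phi)},$$ that is, with variance $\bar\eta^2$. -/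

import Mathlib

open MeasureTheory ProbabilityTheory Filter

namespace DIGAR

/-- The centred bivariate Gaussian law with unit variances and correlation `ρ` (for `|ρ| ≤ 1`): the
law of `(A, ρ A + √(1 - ρ²) B)` with `A`, `B` independent standard normal. -/
noncomputable def stdGaussianPair (ρ : ℝ) : Measure (ℝ × ℝ) :=
  ((gaussianReal 0 1).prod (gaussianReal 0 1)).map
    (fun p : ℝ × ℝ => (p.1, ρ * p.1 + √(1 - ρ ^ 2) * p.2))

/-- The bivariate Gaussian copula with parameter `ρ`: the joint distribution function of
`(Φ(A), Φ(B))`, where `(A, B)` is bivariate Gaussian with standard normal margins and correlation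
`ρ`, and `Φ` is the standard normal distribution function. On `(0,1)²` this is
`C(u, v) = P(A ≤ Φ⁻¹(u), B ≤ Φ⁻¹(v))`. -/
noncomputable def gaussianCopula (ρ u v : ℝ) : ℝ :=
  (stdGaussianPair ρ).real
    {p : ℝ × ℝ | cdf (gaussianReal 0 1) p.1 ≤ u ∧ cdf (gaussianReal 0 1) p.2 ≤ v}

/-- `C` is a copula of the random vector `(X, Y)`, in the sense of Sklar's theorem:
`P(X ≤ x, Y ≤ y) = C(F_X(x), F_Y(y))` for all `x`, `y`. -/
def HasCopula {Ω : Type*} [MeasurableSpace Ω] (P : Measure Ω) (X Y : Ω → ℝ)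
    (C : ℝ → ℝ → ℝ) : Prop :=
  ∀ x y : ℝ, P.real {ω | X ω ≤ x ∧ Y ω ≤ y} = C (cdf (P.map X) x) (cdf (P.map Y) y)

/-- A dependent innovations Gaussian AR(1) process `(Y_t)_{t ≥ 0}` with autoregressive parameter
`φ`, dependence parameter `ρ`, innovation standard deviation `σ` and innovations `(ξ_t)_{t ≥ 1}`
(the value `ξ 0` plays no role). -/
structure IsDIGAR1 {Ω : Type*} [MeasurableSpace Ω] (P : Measure Ω) (φ ρ σ : ℝ)
    (Y ξ : ℕ → Ω → ℝ) : Prop where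
  abs_phi_lt_one : |φ| < 1
  abs_rho_lt_one : |ρ| < 1
  sigma_pos : 0 < σ
  measurable : ∀ t, Measurable (Y t)
  init : ∀ᵐ ω ∂P, Y 0 ω = 0
  recursion : ∀ t, ∀ᵐ ω ∂P, Y (t + 1) ω = φ * Y t ω + ξ (t + 1) ω
  innovation_law : ∀ t, HasLaw (ξ (t + 1)) (gaussianReal 0 (Real.toNNReal (σ ^ 2))) P
  innovation_copula : ∀ t, HasCopula P (ξ (t + 1)) (Y t) (gaussianCopula ρ)

/-- The Markov property with respect to the natural filtration `ℱ_s = σ(Y_0, …, Y_s)`: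
`P(Y_t ∈ B | ℱ_s) = P(Y_t ∈ B | Y_s)` almost surely, for all `s ≤ t` and all Borel sets `B`. -/
def IsMarkovProcess {Ω : Type*} [MeasurableSpace Ω] (P : Measure Ω) (Y : ℕ → Ω → ℝ)
    (hY : ∀ t, Measurable (Y t)) : Prop :=
  ∀ s t : ℕ, s ≤ t → ∀ B : Set ℝ, MeasurableSet B →
    P⟦Y t ⁻¹' B | Filtration.natural Y (fun i => (hY i).stronglyMeasurable) s⟧
      =ᵐ[P] P⟦Y t ⁻¹' B | MeasurableSpace.comap (Y s) inferInstance⟧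

/-- `V_t`, the standard deviation of `Y_t`. -/
noncomputable def stdDev {Ω : Type*} [MeasurableSpace Ω] (P : Measure Ω) (Y : ℕ → Ω → ℝ)
    (t : ℕ) : ℝ :=
  √(Var[Y t; P])

/-- The OLS estimator of `φ` from the sample `(Y_1, …, Y_T)`. -/
noncomputable def olsEstimator {Ω : Type*} (Y : ℕ → Ω → ℝ) (T : ℕ) (ω : Ω) : ℝ :=
  (∑ t ∈ Finset.Icc 2 T, Y t ω * Y (t - 1) ω) / ∑ t ∈ Finset.Icc 2 T, Y (t - 1) ω ^ 2

/-- The infeasible estimator of `φ` from the sample `(Y_1, …, Y_T)`. -/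
noncomputable def infeasibleEstimator {Ω : Type*} [MeasurableSpace Ω] (P : Measure Ω) (ρ σ : ℝ)
    (Y : ℕ → Ω → ℝ) (T : ℕ) (ω : Ω) : ℝ :=
  olsEstimator Y T ω -
    ρ * σ * ((∑ t ∈ Finset.Icc 2 T, Y (t - 1) ω ^ 2 / stdDev P Y (t - 1)) /
      ∑ t ∈ Finset.Icc 2 T, Y (t - 1) ω ^ 2)

/-- The limiting standard deviation `V̄(ρ, φ)` of `Y_t`. -/
noncomputable def limitStdDev (φ ρ σ : ℝ) : ℝ :=
  σ * (ρ * φ + √(ρ ^ 2 * φ ^ 2 + 1 - φ ^ 2)) / (1 - φ ^ 2)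

/-- The asymptotic standard deviation `η̄ = σ √(1 - ρ²) / V̄(ρ, φ)`. -/
noncomputable def asymptoticStdDev (φ ρ σ : ℝ) : ℝ :=
  σ * √(1 - ρ ^ 2) / limitStdDev φ ρ σ

end DIGAR

/-!
Write `V t` for the standard deviation of `Y t` and `s = σ √(1 - ρ²)`. By induction on `t`, the
variable `Y t` is centred Gaussian: the Gaussian copula makes `(ξ (t + 1), Y t)` bivariate Gaussian
with correlation `ρ`, so that `Y (t + 1) = (φ + ρ σ / V t) Y t + s e t`, where the standardised
residual `e t` is a standard normal variable independent of `Y t`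
(`map_residual_prodMk_of_hasCopula_gaussianCopula`, `hasLaw_process`). The Markov property upgrades
this to independence of `e t` from the whole past `Y 0, …, Y t` (`indep_residual_natural`). The
recursion satisfied by `V` is a contraction with constant `|φ|`, whose fixed point is the limiting
standard deviation (`tendsto_sdSeq`), and the slopes `φ + ρ σ / V t` tend to a limit in `(-1, 1)`.

The correction term in the infeasible estimator replaces the constant `φ` by these slopes, hence
`√T` times its error is
`s (T^(-1/2) ∑ Y t e t) / (T⁻¹ ∑ Y t ²)`
almost surely (`infeasibleEstimator_sub_ae_eq`).

* The denominator converges in `L¹` to the square of the limiting standard deviation: summing the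
  recursion for `Y t ²` expresses the sum of squares through boundary terms, a Cesàro-negligible
  term and a sum of orthogonal innovations (`tendsto_integral_abs_mean_sq_sub`).
* The numerator is asymptotically normal. As the errors are exactly Gaussian given the past, the
  process `exp (i u ∑ y t e t + u² / 2 ∑ y t ²)` is a bounded martingale of mean one when the
  regressors `y` are truncated so that their sum of squares stays bounded
  (`integral_expMartingale`); the law of large numbers shows that replacing the sum of squares by
  its limit is harmless, and this computes the limit of the characteristic functions
  (`tendstoInDistribution_sum_mul_errors`).

Slutsky's theorem concludes.
-/

namespace DIGAR

section

/-! ### Bivariate laws and the Gaussian copula -/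

/-- A finite measure on the plane is determined by its joint distribution function. -/
theorem ext_of_Iic_prod_Iic {μ ν : Measure (ℝ × ℝ)} [IsFiniteMeasure μ] [IsFiniteMeasure ν]
    (h : ∀ x y, μ (Set.Iic x ×ˢ Set.Iic y) = ν (Set.Iic x ×ˢ Set.Iic y)) : μ = ν := by
  have h₁ : ∀ (y : ℝ) {s : Set ℝ}, MeasurableSet s →
      μ (s ×ˢ Set.Iic y) = ν (s ×ˢ Set.Iic y) := by
    intro y s hs
    have key : (μ.restrict (Set.univ ×ˢ Set.Iic y)).map Prod.fst
        = (ν.restrict (Set.univ ×ˢ Set.Iic y)).map Prod.fst := by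
      refine Measure.ext_of_Iic _ _ fun x => ?_
      rw [Measure.map_apply measurable_fst measurableSet_Iic,
        Measure.map_apply measurable_fst measurableSet_Iic,
        Measure.restrict_apply (measurable_fst measurableSet_Iic),
        Measure.restrict_apply (measurable_fst measurableSet_Iic), ← Set.prod_univ,
        Set.prod_inter_prod, Set.inter_univ, Set.univ_inter, h]
    have := congrArg (fun m => m s) key
    simp only [Measure.map_apply measurable_fst hs,
      Measure.restrict_apply (measurable_fst hs)] at this
    rwa [← Set.prod_univ, Set.prod_inter_prod, Set.inter_univ, Set.univ_inter] at this
  refine Measure.ext_prod fun {s t} hs ht => ?_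
  have key : (μ.restrict (s ×ˢ Set.univ)).map Prod.snd
      = (ν.restrict (s ×ˢ Set.univ)).map Prod.snd := by
    refine Measure.ext_of_Iic _ _ fun y => ?_
    rw [Measure.map_apply measurable_snd measurableSet_Iic,
      Measure.map_apply measurable_snd measurableSet_Iic,
      Measure.restrict_apply (measurable_snd measurableSet_Iic),
      Measure.restrict_apply (measurable_snd measurableSet_Iic), ← Set.univ_prod,
      Set.prod_inter_prod, Set.inter_univ, Set.univ_inter, h₁ y hs]
  have := congrArg (fun m => m t) key
  simp only [Measure.map_apply measurable_snd ht,
    Measure.restrict_apply (measurable_snd ht)] at this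
  rwa [← Set.univ_prod, Set.prod_inter_prod, Set.inter_univ, Set.univ_inter] at this

theorem strictMono_cdf_gaussianReal (m : ℝ) {v : NNReal} (hv : v ≠ 0) :
    StrictMono (cdf (gaussianReal m v)) := by
  intro x y hxy
  rw [cdf_eq_real, cdf_eq_real, ← Set.Iic_union_Ioc_eq_Iic hxy.le,
    measureReal_union (Set.Iic_disjoint_Ioc le_rfl) measurableSet_Ioc]
  have : (gaussianReal m v) (Set.Ioc x y) ≠ 0 := fun h0 => by
    have := gaussianReal_absolutelyContinuous' m hv h0
    simp at this
    linarith
  have : 0 < (gaussianReal m v).real (Set.Ioc x y) :=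
    measureReal_nonneg.lt_of_ne' (by rwa [ne_eq, measureReal_eq_zero_iff])
  linarith

theorem map_const_mul_stdGaussian (c : ℝ) :
    (gaussianReal 0 1).map (c * ·) = gaussianReal 0 (Real.toNNReal (c ^ 2)) := by
  rw [gaussianReal_map_const_mul, mul_zero, mul_one]
  congr 1
  exact NNReal.eq (by simp [sq_nonneg])

theorem cdf_gaussianReal_toNNReal_sq {c : ℝ} (hc : 0 < c) (x : ℝ) :
    cdf (gaussianReal 0 (Real.toNNReal (c ^ 2))) x = cdf (gaussianReal 0 1) (x / c) := by
  rw [cdf_eq_real, cdf_eq_real, ← map_const_mul_stdGaussian,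
    map_measureReal_apply (by fun_prop) measurableSet_Iic]
  congr 1
  ext z
  simp [le_div_iff₀' hc]

/-- A continuous linear form on `ℝ` is determined by its value at `1`, so this is the Gaussian
characteristic function. -/
theorem charFunDual_stdGaussian (L : StrongDual ℝ ℝ) :
    charFunDual (gaussianReal 0 1) L = Complex.exp (-(L 1 : ℂ) ^ 2 / 2) := by
  rw [charFunDual_eq_charFun_map_one, gaussianReal_map_continuousLinearMap, charFun_gaussianReal]
  congr 1
  simp [sq_nonneg]
  ring

/-- The standard Gaussian law of the plane is invariant under orthogonal reflections. -/
theorem map_reflection_stdGaussian_prod {a b : ℝ} (h : a ^ 2 + b ^ 2 = 1) :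
    ((gaussianReal 0 1).prod (gaussianReal 0 1)).map
      (fun p : ℝ × ℝ => (b * p.1 - a * p.2, a * p.1 + b * p.2))
      = (gaussianReal 0 1).prod (gaussianReal 0 1) := by
  let R : ℝ × ℝ →L[ℝ] ℝ × ℝ :=
    (b • ContinuousLinearMap.fst ℝ ℝ ℝ - a • ContinuousLinearMap.snd ℝ ℝ ℝ).prod
      (a • ContinuousLinearMap.fst ℝ ℝ ℝ + b • ContinuousLinearMap.snd ℝ ℝ ℝ)
  have hR : (fun p : ℝ × ℝ => (b * p.1 - a * p.2, a * p.1 + b * p.2)) = R := by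
    ext p <;> simp [R]
  rw [hR]
  refine Measure.ext_of_charFunDual ?_
  ext L
  have hL : ∀ x y : ℝ, L (x, y) = x * L (1, 0) + y * L (0, 1) := by
    intro x y
    have : ((x, y) : ℝ × ℝ) = x • ((1, 0) : ℝ × ℝ) + y • ((0, 1) : ℝ × ℝ) := by
      ext <;> simp
    rw [this, map_add, map_smul, map_smul, smul_eq_mul, smul_eq_mul]
  rw [charFunDual_map, charFunDual_prod, charFunDual_prod, charFunDual_stdGaussian,
    charFunDual_stdGaussian, charFunDual_stdGaussian, charFunDual_stdGaussian, ← Complex.exp_add,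
    ← Complex.exp_add]
  congr 1
  have h' : ((a : ℂ)) ^ 2 + (b : ℂ) ^ 2 = 1 := by exact_mod_cast h
  have e1 : (L.comp R).comp (ContinuousLinearMap.inl ℝ ℝ ℝ) 1
      = b * L (1, 0) + a * L (0, 1) := by
    simp [R]; rw [hL]
  have e2 : (L.comp R).comp (ContinuousLinearMap.inr ℝ ℝ ℝ) 1
      = -a * L (1, 0) + b * L (0, 1) := by
    simp [R]; rw [hL]; ring
  rw [e1, e2]
  simp only [ContinuousLinearMap.comp_apply, ContinuousLinearMap.inl_apply,
    ContinuousLinearMap.inr_apply]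
  push_cast
  linear_combination (-((L (1, 0) : ℂ)) ^ 2 / 2 - ((L (0, 1) : ℂ)) ^ 2 / 2) * h'

variable {Ω : Type*} [MeasurableSpace Ω] {P : Measure Ω}

/-- Two centred Gaussian variables with standard deviations `σ`, `V` and Gaussian copula are
jointly distributed as `(σ A, V B)` with `(A, B)` a standard Gaussian pair. -/
theorem map_prodMk_of_hasCopula_gaussianCopula [IsProbabilityMeasure P] {ρ σ V : ℝ} (hσ : 0 < σ)
    (hV : 0 < V) {X Y : Ω → ℝ} (hX : HasLaw X (gaussianReal 0 (Real.toNNReal (σ ^ 2))) P)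
    (hY : HasLaw Y (gaussianReal 0 (Real.toNNReal (V ^ 2))) P)
    (hC : HasCopula P X Y (gaussianCopula ρ)) :
    P.map (fun ω => (X ω, Y ω))
      = (stdGaussianPair ρ).map (fun p : ℝ × ℝ => (σ * p.1, V * p.2)) := by
  have hm : AEMeasurable (fun ω => (X ω, Y ω)) P := hX.aemeasurable.prodMk hY.aemeasurable
  have : IsProbabilityMeasure (stdGaussianPair ρ) :=
    Measure.isProbabilityMeasure_map (by fun_prop)
  have hm' : Measurable (fun p : ℝ × ℝ => (σ * p.1, V * p.2)) := by fun_prop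
  refine ext_of_Iic_prod_Iic fun x y => ?_
  rw [Measure.map_apply_of_aemeasurable hm (measurableSet_Iic.prod measurableSet_Iic),
    Measure.map_apply hm' (measurableSet_Iic.prod measurableSet_Iic),
    ← measureReal_eq_measureReal_iff]
  have h := hC x y
  rw [hX.map_eq, hY.map_eq, cdf_gaussianReal_toNNReal_sq hσ, cdf_gaussianReal_toNNReal_sq hV,
    gaussianCopula] at h
  refine Eq.trans h ?_
  congr 1
  ext p
  have hs := strictMono_cdf_gaussianReal 0 one_ne_zero
  simp [hs.le_iff_le, le_div_iff₀' hσ, le_div_iff₀' hV]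

/-- Regression of `X` on `Y` under a Gaussian copula: the standardised residual is a standard
normal variable independent of `Y`. -/
theorem map_residual_prodMk_of_hasCopula_gaussianCopula [IsProbabilityMeasure P] {ρ σ V : ℝ}
    (hρ : |ρ| < 1) (hσ : 0 < σ)
    (hV : 0 < V) {X Y : Ω → ℝ} (hX : HasLaw X (gaussianReal 0 (Real.toNNReal (σ ^ 2))) P)
    (hY : HasLaw Y (gaussianReal 0 (Real.toNNReal (V ^ 2))) P)
    (hC : HasCopula P X Y (gaussianCopula ρ)) :
    P.map (fun ω => ((X ω - ρ * σ / V * Y ω) / (σ * √(1 - ρ ^ 2)), Y ω))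
      = (gaussianReal 0 1).prod (gaussianReal 0 (Real.toNNReal (V ^ 2))) := by
  have hm : AEMeasurable (fun ω => (X ω, Y ω)) P := hX.aemeasurable.prodMk hY.aemeasurable
  have hρ2 : 0 < 1 - ρ ^ 2 := by
    have := (sq_lt_one_iff_abs_lt_one ρ).2 hρ
    linarith
  have hc : 0 < √(1 - ρ ^ 2) := Real.sqrt_pos.2 hρ2
  have hc2 : √(1 - ρ ^ 2) ^ 2 = 1 - ρ ^ 2 := Real.sq_sqrt hρ2.le
  have h := map_prodMk_of_hasCopula_gaussianCopula hσ hV hX hY hC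
  let f : ℝ × ℝ → ℝ × ℝ :=
    fun p => ((p.1 - ρ * σ / V * p.2) / (σ * √(1 - ρ ^ 2)), p.2)
  have hf : Measurable f := by fun_prop
  have e : P.map (fun ω => ((X ω - ρ * σ / V * Y ω) / (σ * √(1 - ρ ^ 2)), Y ω))
      = (P.map (fun ω => (X ω, Y ω))).map f := by
    rw [AEMeasurable.map_map_of_aemeasurable hf.aemeasurable hm]; rfl
  rw [e, h, stdGaussianPair, Measure.map_map (by fun_prop) (by fun_prop),
    Measure.map_map (by fun_prop) (by fun_prop), ← map_const_mul_stdGaussian V]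
  have hmap : (gaussianReal 0 1).prod ((gaussianReal 0 1).map (V * ·))
      = ((gaussianReal 0 1).prod (gaussianReal 0 1)).map (Prod.map id (V * ·)) := by
    rw [← Measure.map_prod_map _ _ measurable_id (by fun_prop), Measure.map_id]
  rw [hmap]
  conv_rhs =>
    rw [← map_reflection_stdGaussian_prod (a := ρ) (b := √(1 - ρ ^ 2)) (by rw [hc2]; ring)]
  rw [Measure.map_map (by fun_prop) (by fun_prop)]
  congr 1
  ext p
  · simp only [f, Function.comp, Prod.map, id]
    field_simp
    linear_combination (-p.1) * hc2
  · simp [f]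

end

/-! ### The Markov property and independence of the residuals from the past -/

/-- Conditional expectation is self-adjoint, for indicator functions. -/
theorem setIntegral_condProb_comm {Ω : Type*} {m mΩ : MeasurableSpace Ω} {P : Measure Ω}
    [IsFiniteMeasure P] (hm : m ≤ mΩ) {A E : Set Ω} (hA : MeasurableSet A)
    (hE : MeasurableSet E) : ∫ ω in E, (P⟦A | m⟧) ω ∂P = ∫ ω in A, (P⟦E | m⟧) ω ∂P := by
  have key : ∀ {A E : Set Ω}, MeasurableSet A → MeasurableSet E →
      ∫ ω in E, (P⟦A | m⟧) ω ∂P = ∫ ω, (P⟦E | m⟧) ω * (P⟦A | m⟧) ω ∂P := by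
    intro A E hA hE
    have hfun : E.indicator (P⟦A | m⟧) = E.indicator (fun _ => (1 : ℝ)) * P⟦A | m⟧ := by
      ext ω
      by_cases h : ω ∈ E <;> simp [h]
    rw [← integral_indicator hE, ← integral_condExp hm, hfun]
    refine integral_congr_ae (condExp_mul_of_stronglyMeasurable_right stronglyMeasurable_condExp
      ?_ ((integrable_const _).indicator hE))
    rw [← hfun]
    exact integrable_condExp.indicator hE
  rw [key hA hE, key hE hA]
  simp_rw [mul_comm]

/-- If `W` is conditionally independent of `F` given the `F`-measurable variable `Z`, then a
function of `(Z, W)` which is independent of `Z` is independent of `F`. -/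
theorem indep_comap_of_condExp_eq {Ω : Type*} {m F mΩ : MeasurableSpace Ω} {P : Measure Ω}
    [IsProbabilityMeasure P] (hF : F ≤ mΩ) {Z W : Ω → ℝ} (hZ : Measurable[F] Z)
    (hW : Measurable W) (hm : m = MeasurableSpace.comap Z inferInstance)
    (hM : ∀ B : Set ℝ, MeasurableSet B →
      P⟦W ⁻¹' B | F⟧ =ᵐ[P] P⟦W ⁻¹' B | m⟧)
    {g : ℝ × ℝ → ℝ} (hg : Measurable g) (hind : IndepFun (fun ω => g (Z ω, W ω)) Z P) :
    Indep (MeasurableSpace.comap (fun ω => g (Z ω, W ω)) inferInstance) F P := by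
  have hZ' : Measurable Z := hZ.mono hF le_rfl
  have hσF : m ≤ F := hm ▸ hZ.comap_le
  have hσ : m ≤ mΩ := hσF.trans hF
  rw [Indep_iff]
  rintro t A ⟨C, hC, rfl⟩ hA
  have hAm : MeasurableSet A := hF _ hA
  set T : Ω → ℝ × ℝ := fun ω => (Z ω, W ω) with hT
  have hTm : Measurable T := hZ'.prodMk hW
  have hnn : 0 ≤ᵐ[P] P⟦A | m⟧ := condExp_nonneg
    (ae_of_all _ fun ω => Set.indicator_nonneg (fun _ _ => zero_le_one) ω)
  -- The measures `E ↦ P(A ∩ {T ∈ E})` and `E ↦ ∫_{T ∈ E} P(A | Z)` agree.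
  have hν' : ∀ E, MeasurableSet E →
      ((P.withDensity fun ω => ENNReal.ofReal ((P⟦A | m⟧) ω)).map T) E
        = ENNReal.ofReal (∫ ω in A, (P⟦T ⁻¹' E | m⟧) ω ∂P) := by
    intro E hE
    rw [Measure.map_apply hTm hE, withDensity_apply _ (hTm hE),
      ← setIntegral_condProb_comm hσ hAm (hTm hE),
      ofReal_integral_eq_lintegral_ofReal integrable_condExp.integrableOn
        (ae_restrict_of_ae hnn)]
  have hν : (P.restrict A).map T
      = (P.withDensity fun ω => ENNReal.ofReal ((P⟦A | m⟧) ω)).map T := by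
    refine Measure.ext_prod fun {D B} hD hB => ?_
    rw [hν' _ (hD.prod hB), Measure.map_apply hTm (hD.prod hB),
      Measure.restrict_apply (hTm (hD.prod hB))]
    have hDm : MeasurableSet[m] (Z ⁻¹' D) := hm ▸ ⟨D, hD, rfl⟩
    have hpre : (T ⁻¹' (D ×ˢ B)).indicator (fun _ => (1 : ℝ))
        = (Z ⁻¹' D).indicator ((W ⁻¹' B).indicator fun _ => (1 : ℝ)) := by
      rw [Set.indicator_indicator]; rfl
    have hint : Integrable ((W ⁻¹' B).indicator fun _ => (1 : ℝ)) P :=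
      (integrable_const _).indicator (hW hB)
    have h1 : P⟦T ⁻¹' (D ×ˢ B) | m⟧ =ᵐ[P] P⟦T ⁻¹' (D ×ˢ B) | F⟧ := by
      rw [hpre]
      refine (condExp_indicator hint hDm).trans
        (EventuallyEq.trans ?_ (condExp_indicator hint (hσF _ hDm)).symm)
      filter_upwards [hM B hB] with ω hω
      by_cases h : ω ∈ Z ⁻¹' D <;> simp only [Set.indicator, h, if_true, if_false, hω]
    rw [setIntegral_congr_ae hAm (h1.mono fun ω hω _ => hω),
      setIntegral_condExp hF ((integrable_const _).indicator (hTm (hD.prod hB))) hA,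
      setIntegral_indicator (hTm (hD.prod hB)), setIntegral_const, smul_eq_mul, mul_one,
      ofReal_measureReal, Set.inter_comm]
  have hgC := congrArg (fun ν => ν (g ⁻¹' C)) hν
  simp only [hν' _ (hg hC), Measure.map_apply hTm (hg hC),
    Measure.restrict_apply (hTm (hg hC))] at hgC
  have hgm : Measurable (fun ω => g (Z ω, W ω)) := hg.comp hTm
  have hci : P⟦T ⁻¹' (g ⁻¹' C) | m⟧ =ᵐ[P] fun _ => P.real (T ⁻¹' (g ⁻¹' C)) := by
    have := condExp_indep_eq (μ := P) hgm.comap_le hσ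
      (f := (T ⁻¹' (g ⁻¹' C)).indicator fun _ => (1 : ℝ))
      (stronglyMeasurable_const.indicator ⟨C, hC, rfl⟩) (hm ▸ (IndepFun_iff_Indep _ _ _).1 hind)
    refine this.trans (ae_of_all _ fun ω => ?_)
    simp only
    rw [integral_indicator (hTm (hg hC)), setIntegral_const, smul_eq_mul, mul_one]
  rw [setIntegral_congr_ae hAm (hci.mono fun ω hω _ => hω), setIntegral_const, smul_eq_mul,
    ENNReal.ofReal_mul measureReal_nonneg, ofReal_measureReal,
    ofReal_measureReal, mul_comm] at hgC
  exact hgC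

section

/-! ### The standard deviations and the residuals of a DIGAR(1) process -/

/-- The standard deviations of a DIGAR(1) process, as the solution of the recursion
`V₀ = 0`, `V_{t+1}² = (φ V_t + ρ σ)² + σ² (1 - ρ²)`. -/
noncomputable def sdSeq (φ ρ σ : ℝ) : ℕ → ℝ
  | 0 => 0
  | t + 1 => √((φ * sdSeq φ ρ σ t + ρ * σ) ^ 2 + (σ * √(1 - ρ ^ 2)) ^ 2)

/-- The slope of the regression of `Y_{t+1}` on `Y_t`, which is `φ + ρ σ / V_t`. At `t = 0`,
where `V_t = 0`, it is `φ`; only the times `t ≥ 1` matter. -/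
noncomputable def slope (φ ρ σ : ℝ) (t : ℕ) : ℝ := φ + ρ * σ / sdSeq φ ρ σ t

/-- The standardised residual of the regression of `Y_{t+1}` on `Y_t`. -/
noncomputable def residual {Ω : Type*} (φ ρ σ : ℝ) (Y : ℕ → Ω → ℝ) (t : ℕ) (ω : Ω) : ℝ :=
  (Y (t + 1) ω - slope φ ρ σ t * Y t ω) / (σ * √(1 - ρ ^ 2))

variable {φ ρ σ : ℝ}

theorem sqrt_one_sub_sq_pos (hρ : |ρ| < 1) : 0 < √(1 - ρ ^ 2) := by
  have := (sq_lt_one_iff_abs_lt_one ρ).2 hρ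
  exact Real.sqrt_pos.2 (by linarith)

theorem process_succ {Ω : Type*} {Y : ℕ → Ω → ℝ} (hρ : |ρ| < 1) (hσ : 0 < σ) (t : ℕ) (ω : Ω) :
    Y (t + 1) ω
      = slope φ ρ σ t * Y t ω + σ * √(1 - ρ ^ 2) * residual φ ρ σ Y t ω := by
  rw [residual, mul_div_cancel₀ _ (mul_pos hσ (sqrt_one_sub_sq_pos hρ)).ne']
  ring

theorem sdSeq_succ_pos (hρ : |ρ| < 1) (hσ : 0 < σ) (t : ℕ) : 0 < sdSeq φ ρ σ (t + 1) := by
  have := sqrt_one_sub_sq_pos hρ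
  exact Real.sqrt_pos.2 (by positivity)

theorem sdSeq_nonneg (t : ℕ) : 0 ≤ sdSeq φ ρ σ t := by
  cases t with
  | zero => exact le_rfl
  | succ t => exact Real.sqrt_nonneg _

theorem limitStdDev_pos (hφ : |φ| < 1) (hσ : 0 < σ) : 0 < limitStdDev φ ρ σ := by
  have hφ2 : 0 < 1 - φ ^ 2 := by
    have := (sq_lt_one_iff_abs_lt_one φ).2 hφ
    linarith
  have h : |ρ * φ| < √(ρ ^ 2 * φ ^ 2 + 1 - φ ^ 2) := by
    rw [Real.lt_sqrt (abs_nonneg _), sq_abs]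
    nlinarith
  have h2 := neg_abs_le (ρ * φ)
  exact div_pos (mul_pos hσ (by linarith)) hφ2

theorem limitStdDev_sq (hφ : |φ| < 1) (hρ : |ρ| < 1) :
    limitStdDev φ ρ σ ^ 2
      = (φ * limitStdDev φ ρ σ + ρ * σ) ^ 2 + (σ * √(1 - ρ ^ 2)) ^ 2 := by
  have hφ2 : 0 < 1 - φ ^ 2 := by
    have := (sq_lt_one_iff_abs_lt_one φ).2 hφ
    linarith
  have hρ2 : 0 ≤ 1 - ρ ^ 2 := by
    have := (sq_lt_one_iff_abs_lt_one ρ).2 hρ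
    linarith
  have hr : √(ρ ^ 2 * φ ^ 2 + 1 - φ ^ 2) ^ 2 = ρ ^ 2 * φ ^ 2 + 1 - φ ^ 2 :=
    Real.sq_sqrt (by nlinarith [sq_nonneg (ρ * φ)])
  rw [mul_pow σ, Real.sq_sqrt hρ2, limitStdDev]
  set r := √(ρ ^ 2 * φ ^ 2 + 1 - φ ^ 2)
  field_simp
  linear_combination σ ^ 2 * (1 - φ ^ 2) * hr

/-- The recursion for the standard deviations is a contraction with constant `|φ|`. -/
theorem tendsto_sdSeq (hφ : |φ| < 1) (hρ : |ρ| < 1) (hσ : 0 < σ) :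
    Tendsto (sdSeq φ ρ σ) atTop (nhds (limitStdDev φ ρ σ)) := by
  set L := limitStdDev φ ρ σ with hL
  set s := σ * √(1 - ρ ^ 2) with hs
  have hs0 : 0 < s := mul_pos hσ (sqrt_one_sub_sq_pos hρ)
  have hLpos : 0 < L := limitStdDev_pos hφ hσ
  have hfix : √((φ * L + ρ * σ) ^ 2 + s ^ 2) = L := by
    rw [← limitStdDev_sq hφ hρ, Real.sqrt_sq hLpos.le]
  -- The function `x ↦ √(x² + s²)` is 1-Lipschitz.
  have hlip : ∀ x y : ℝ, |√(x ^ 2 + s ^ 2) - √(y ^ 2 + s ^ 2)| ≤ |x - y| := by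
    intro x y
    have hx : |x| ≤ √(x ^ 2 + s ^ 2) := Real.abs_le_sqrt (by nlinarith)
    have hy : |y| ≤ √(y ^ 2 + s ^ 2) := Real.abs_le_sqrt (by nlinarith)
    have hx2 := Real.sq_sqrt (show 0 ≤ x ^ 2 + s ^ 2 by positivity)
    have hy2 := Real.sq_sqrt (show 0 ≤ y ^ 2 + s ^ 2 by positivity)
    have hx0 : 0 < √(x ^ 2 + s ^ 2) := Real.sqrt_pos.2 (by positivity)
    have hy0 : 0 < √(y ^ 2 + s ^ 2) := Real.sqrt_pos.2 (by positivity)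
    set u := √(x ^ 2 + s ^ 2)
    set w := √(y ^ 2 + s ^ 2)
    have h1 : |u - w| * (u + w) = |x - y| * |x + y| := by
      have : |u - w| * (u + w) = |(u - w) * (u + w)| := by
        rw [abs_mul, abs_of_pos (add_pos hx0 hy0)]
      rw [this, ← abs_mul]
      congr 1
      linear_combination hx2 - hy2
    have h2 : |x + y| ≤ u + w := (abs_add_le x y).trans (add_le_add hx hy)
    have h3 : |u - w| * (u + w) ≤ |x - y| * (u + w) :=
      h1 ▸ mul_le_mul_of_nonneg_left h2 (abs_nonneg _)
    exact le_of_mul_le_mul_right h3 (add_pos hx0 hy0)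
  have hstep : ∀ t, |sdSeq φ ρ σ t - L| ≤ |φ| ^ t * |L| := by
    intro t
    induction t with
    | zero => simp [sdSeq]
    | succ t ih =>
      have h := hlip (φ * sdSeq φ ρ σ t + ρ * σ) (φ * L + ρ * σ)
      rw [hfix] at h
      refine h.trans ?_
      rw [show φ * sdSeq φ ρ σ t + ρ * σ - (φ * L + ρ * σ) = φ * (sdSeq φ ρ σ t - L) by ring,
        abs_mul, pow_succ', mul_assoc]
      exact mul_le_mul_of_nonneg_left ih (abs_nonneg _)
  rw [tendsto_iff_norm_sub_tendsto_zero]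
  refine squeeze_zero (fun _ => norm_nonneg _) hstep ?_
  simpa using (tendsto_pow_atTop_nhds_zero_of_lt_one (abs_nonneg φ) hφ).mul_const |L|

theorem tendsto_slope (hφ : |φ| < 1) (hρ : |ρ| < 1) (hσ : 0 < σ) :
    Tendsto (slope φ ρ σ) atTop (nhds (φ + ρ * σ / limitStdDev φ ρ σ)) :=
  tendsto_const_nhds.add
    (tendsto_const_nhds.div (tendsto_sdSeq hφ hρ hσ) (limitStdDev_pos hφ hσ).ne')

/-- The limiting standard deviation is that of the stationary AR(1) process with the limiting
slope. -/
theorem one_sub_slope_sq_mul_limitStdDev_sq (hφ : |φ| < 1) (hρ : |ρ| < 1) (hσ : 0 < σ) :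
    (1 - (φ + ρ * σ / limitStdDev φ ρ σ) ^ 2) * limitStdDev φ ρ σ ^ 2
      = (σ * √(1 - ρ ^ 2)) ^ 2 := by
  have hL := limitStdDev_pos (ρ := ρ) hφ hσ
  have h := limitStdDev_sq (σ := σ) hφ hρ
  set L := limitStdDev φ ρ σ
  have : (φ + ρ * σ / L) * L = φ * L + ρ * σ := by field_simp
  rw [sub_mul, one_mul, ← mul_pow, this]
  linarith

variable {Ω : Type*} [MeasurableSpace Ω] {P : Measure Ω} [IsProbabilityMeasure P]
  {Y ξ : ℕ → Ω → ℝ}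

theorem map_residual_prodMk (h : IsDIGAR1 P φ ρ σ Y ξ) {t : ℕ} (ht : t ≠ 0)
    (hY : HasLaw (Y t) (gaussianReal 0 (Real.toNNReal (sdSeq φ ρ σ t ^ 2))) P) :
    P.map (fun ω => (residual φ ρ σ Y t ω, Y t ω))
      = (gaussianReal 0 1).prod (gaussianReal 0 (Real.toNNReal (sdSeq φ ρ σ t ^ 2))) := by
  obtain ⟨k, rfl⟩ := Nat.exists_eq_succ_of_ne_zero ht
  rw [← map_residual_prodMk_of_hasCopula_gaussianCopula h.abs_rho_lt_one h.sigma_pos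
    (sdSeq_succ_pos h.abs_rho_lt_one h.sigma_pos k) (h.innovation_law _) hY (h.innovation_copula _)]
  refine Measure.map_congr ?_
  filter_upwards [h.recursion (k + 1)] with ω hω
  simp only [residual, slope, hω]
  congr 2
  ring

theorem indepFun_residual_of_hasLaw (h : IsDIGAR1 P φ ρ σ Y ξ) {t : ℕ} (ht : t ≠ 0)
    (hY : HasLaw (Y t) (gaussianReal 0 (Real.toNNReal (sdSeq φ ρ σ t ^ 2))) P) :
    HasLaw (residual φ ρ σ Y t) (gaussianReal 0 1) P ∧ IndepFun (residual φ ρ σ Y t) (Y t) P := by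
  have hm := map_residual_prodMk h ht hY
  have hYm := h.measurable
  have hr : Measurable (residual φ ρ σ Y t) := by unfold residual; fun_prop
  have hlaw : P.map (residual φ ρ σ Y t) = gaussianReal 0 1 := by
    rw [← Measure.fst_map_prodMk (hYm t), hm, Measure.fst_prod]
  refine ⟨⟨hr.aemeasurable, hlaw⟩, ?_⟩
  rw [indepFun_iff_map_prod_eq_prod_map_map hr.aemeasurable (hYm t).aemeasurable, hm, hlaw,
    hY.map_eq]

theorem hasLaw_process (h : IsDIGAR1 P φ ρ σ Y ξ) (t : ℕ) :
    HasLaw (Y t) (gaussianReal 0 (Real.toNNReal (sdSeq φ ρ σ t ^ 2))) P := by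
  have hρ := h.abs_rho_lt_one
  have hσ := h.sigma_pos
  induction t with
  | zero =>
    refine ⟨(h.measurable 0).aemeasurable, ?_⟩
    rw [Measure.map_congr h.init]
    simp [sdSeq]
  | succ t ih =>
    rcases eq_or_ne t 0 with rfl | ht
    -- At the first step the copula carries no information, but `Y₁ = ξ₁` almost surely.
    · have hV : sdSeq φ ρ σ 1 ^ 2 = σ ^ 2 := by
        have : 0 ≤ 1 - ρ ^ 2 := by
          have := (sq_lt_one_iff_abs_lt_one ρ).2 hρ
          linarith
        rw [sdSeq, sdSeq, Real.sq_sqrt (by positivity), mul_pow σ, Real.sq_sqrt this]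
        ring
      rw [zero_add, hV]
      refine (h.innovation_law 0).congr ?_
      filter_upwards [h.init, h.recursion 0] with ω h0 h1
      simpa [h0] using h1
    · obtain ⟨hlaw, hind⟩ := indepFun_residual_of_hasLaw h ht ih
      obtain ⟨k, rfl⟩ := Nat.exists_eq_succ_of_ne_zero ht
      have hV := sdSeq_succ_pos (φ := φ) hρ hσ k
      have hs := mul_pos hσ (sqrt_one_sub_sq_pos hρ)
      have h1 := gaussianReal_const_mul ih (slope φ ρ σ (k + 1))
      have h2 := gaussianReal_const_mul hlaw (σ * √(1 - ρ ^ 2))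
      have hi : IndepFun (fun ω => slope φ ρ σ (k + 1) * Y (k + 1) ω)
          (fun ω => σ * √(1 - ρ ^ 2) * residual φ ρ σ Y (k + 1) ω) P :=
        hind.symm.comp (measurable_const_mul _) (measurable_const_mul _)
      have h3 := gaussianReal_add_gaussianReal_of_indepFun hi h1.map_eq h2.map_eq
      refine ⟨(h.measurable _).aemeasurable, ?_⟩
      convert h3 using 1
      · congr 1
        ext ω
        exact process_succ hρ hσ (k + 1) ω
      · congr 1
        · simp
        · refine NNReal.eq ?_
          rw [sdSeq, Real.sq_sqrt (by positivity)]
          simp only [NNReal.coe_add, NNReal.coe_mul, NNReal.coe_mk, mul_one]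
          rw [Real.coe_toNNReal _ (by positivity), Real.coe_toNNReal _ (by positivity), ← mul_pow]
          congr 2
          rw [slope]
          field_simp

theorem stdDev_eq_sdSeq (h : IsDIGAR1 P φ ρ σ Y ξ) (t : ℕ) : stdDev P Y t = sdSeq φ ρ σ t := by
  rw [stdDev, (hasLaw_process h t).variance_eq, variance_id_gaussianReal,
    Real.coe_toNNReal _ (sq_nonneg _), Real.sqrt_sq (sdSeq_nonneg t)]

theorem hasLaw_residual (h : IsDIGAR1 P φ ρ σ Y ξ) {t : ℕ} (ht : t ≠ 0) :
    HasLaw (residual φ ρ σ Y t) (gaussianReal 0 1) P :=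
  (indepFun_residual_of_hasLaw h ht (hasLaw_process h t)).1

/-- The residual at time `t + 1` is independent of the past up to time `t`, by the Markov
property. -/
theorem indep_residual_natural (h : IsDIGAR1 P φ ρ σ Y ξ)
    (hM : IsMarkovProcess P Y h.measurable) {t : ℕ} (ht : t ≠ 0) :
    Indep (MeasurableSpace.comap (residual φ ρ σ Y t) inferInstance)
      (Filtration.natural Y (fun i => (h.measurable i).stronglyMeasurable) t) P := by
  have hZ : Measurable[Filtration.natural Y (fun i => (h.measurable i).stronglyMeasurable) t]
      (Y t) :=
    (Filtration.stronglyAdapted_natural (fun i => (h.measurable i).stronglyMeasurable) t).measurable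
  exact indep_comap_of_condExp_eq (Filtration.le _ t) hZ (h.measurable (t + 1)) rfl
    (fun B hB => hM t (t + 1) t.le_succ B hB)
    (g := fun p => (p.2 - slope φ ρ σ t * p.1) / (σ * √(1 - ρ ^ 2))) (by fun_prop)
    (indepFun_residual_of_hasLaw h ht (hasLaw_process h t)).2

end

/-! ### Law of large numbers for the squared regressor -/

/-- A regressor `X` adapted to the filtration `G`, with standard Gaussian errors `e`, where `e n` is
observed at time `n + 1` and independent of the past `G n`. -/
structure HasGaussianErrors {Ω : Type*} {mΩ : MeasurableSpace Ω} (P : Measure Ω)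
    (G : Filtration ℕ mΩ) (X e : ℕ → Ω → ℝ) : Prop where
  adapted : ∀ n, Measurable[G n] (X n)
  errors_measurable : ∀ n, Measurable[G (n + 1)] (e n)
  errors_law : ∀ n, HasLaw (e n) (gaussianReal 0 1) P
  errors_indep : ∀ n, Indep (MeasurableSpace.comap (e n) inferInstance) (G n) P

theorem integral_sq_stdGaussian : ∫ z, z ^ 2 ∂(gaussianReal 0 1) = 1 := by
  have h := variance_fun_id_gaussianReal (μ := 0) (v := 1)
  rw [variance_eq_integral measurable_id'.aemeasurable] at h
  simpa using h

theorem integrable_pow_stdGaussian (k : ℕ) :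
    Integrable (fun z : ℝ => z ^ k) (gaussianReal 0 1) := by
  have := (memLp_id_gaussianReal (μ := 0) (v := 1) k).integrable_norm_pow' (p := k)
  refine (this.mono' (by fun_prop) (ae_of_all _ fun z => ?_))
  simp

theorem integrable_sq_sub_one_sq_stdGaussian :
    Integrable (fun z : ℝ => (z ^ 2 - 1) ^ 2) (gaussianReal 0 1) := by
  have : (fun z : ℝ => (z ^ 2 - 1) ^ 2) = fun z => z ^ 4 - 2 * z ^ 2 + 1 := by ext; ring
  rw [this]
  exact ((integrable_pow_stdGaussian 4).sub ((integrable_pow_stdGaussian 2).const_mul 2)).add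
    (integrable_const 1)

namespace HasGaussianErrors

variable {Ω : Type*} {mΩ : MeasurableSpace Ω} {P : Measure Ω}
  {G : Filtration ℕ mΩ} {X e : ℕ → Ω → ℝ}

theorem measurable (h : HasGaussianErrors P G X e) (n : ℕ) : Measurable (X n) :=
  (h.adapted n).mono (G.le n) le_rfl

theorem measurable_errors (h : HasGaussianErrors P G X e) (n : ℕ) : Measurable (e n) :=
  (h.errors_measurable n).mono (G.le (n + 1)) le_rfl

theorem indepFun (h : HasGaussianErrors P G X e) {β : Type*} [MeasurableSpace β] {n : ℕ}
    {f : Ω → β} (hf : Measurable[G n] f) : IndepFun f (e n) P := by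
  rw [IndepFun_iff_Indep]
  exact (indep_of_indep_of_le_right (h.errors_indep n) hf.comap_le).symm

theorem integral_comp_errors (h : HasGaussianErrors P G X e) (n : ℕ) {f : ℝ → ℝ}
    (hf : Measurable f) : ∫ ω, f (e n ω) ∂P = ∫ z, f z ∂(gaussianReal 0 1) := by
  rw [← (h.errors_law n).map_eq, integral_map (h.errors_law n).aemeasurable (by fun_prop)]

theorem integrable_comp_errors (h : HasGaussianErrors P G X e) (n : ℕ) {f : ℝ → ℝ}
    (hi : Integrable f (gaussianReal 0 1)) : Integrable (fun ω => f (e n ω)) P := by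
  rw [← (h.errors_law n).map_eq] at hi
  exact hi.comp_aemeasurable (h.errors_law n).aemeasurable

/-- The errors have conditional expectation zero given the past, and so has any centred function of
them. -/
theorem integral_mul_comp_errors_eq_zero (h : HasGaussianErrors P G X e) {n : ℕ} {S : Ω → ℝ}
    (hS : Measurable[G n] S) {f : ℝ → ℝ} (hf : Measurable f)
    (h0 : ∫ z, f z ∂(gaussianReal 0 1) = 0) : ∫ ω, S ω * f (e n ω) ∂P = 0 := by
  have := ((h.indepFun hS).comp measurable_id hf).integral_fun_mul_eq_mul_integral
    (hS.mono (G.le n) le_rfl).aestronglyMeasurable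
    (hf.comp (h.measurable_errors n)).aestronglyMeasurable
  simp only [Function.comp_def, id] at this
  rw [this, h.integral_comp_errors n hf, h0, mul_zero]

theorem integrable_mul_comp_errors (h : HasGaussianErrors P G X e) {n : ℕ} {S : Ω → ℝ}
    (hS : Measurable[G n] S) (hSi : Integrable S P) {f : ℝ → ℝ} (hf : Measurable f)
    (hi : Integrable f (gaussianReal 0 1)) : Integrable (fun ω => S ω * f (e n ω)) P :=
  ((h.indepFun hS).comp measurable_id hf).integrable_mul hSi (h.integrable_comp_errors n hi)

/-- The innovation `X_{n+1}² - E(X_{n+1}² | G_n)` of the squared process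
when `X_{n+1} = α_n X_n + s e_n`. -/
noncomputable def sqInnovation (X e : ℕ → Ω → ℝ) (α : ℕ → ℝ) (s : ℝ) (n : ℕ) (ω : Ω) : ℝ :=
  2 * α n * s * (X n ω * e n ω) + s ^ 2 * (e n ω ^ 2 - 1)

theorem memLp_sqInnovation [IsProbabilityMeasure P] (h : HasGaussianErrors P G X e) (α : ℕ → ℝ)
    (s : ℝ) {n : ℕ} (hX : MemLp (X n) 2 P) : MemLp (sqInnovation X e α s n) 2 P := by
  have hXm := h.measurable n
  have hem := h.measurable_errors n
  have h1 : MemLp (fun ω => X n ω * e n ω) 2 P := by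
    rw [memLp_two_iff_integrable_sq (by fun_prop)]
    simp_rw [mul_pow]
    exact h.integrable_mul_comp_errors ((h.adapted n).pow_const 2) hX.integrable_sq
      (f := fun z => z ^ 2) (by fun_prop) (integrable_pow_stdGaussian 2)
  have h2 : MemLp (fun ω => e n ω ^ 2 - 1) 2 P := by
    rw [memLp_two_iff_integrable_sq (by fun_prop)]
    exact h.integrable_comp_errors n (f := fun z => (z ^ 2 - 1) ^ 2)
      integrable_sq_sub_one_sq_stdGaussian
  exact (h1.const_mul _).add (h2.const_mul _)

/-- Second moment bound for the innovations of the squared process. -/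
theorem integral_sqInnovation_sq_le [IsProbabilityMeasure P] (h : HasGaussianErrors P G X e)
    {α : ℕ → ℝ} {s A K : ℝ} {n : ℕ} (hX : MemLp (X n) 2 P) (hα : |α n| ≤ A)
    (hK : ∫ ω, X n ω ^ 2 ∂P ≤ K) :
    ∫ ω, sqInnovation X e α s n ω ^ 2 ∂P
      ≤ 8 * A ^ 2 * s ^ 2 * K + 2 * s ^ 4 * ∫ z, (z ^ 2 - 1) ^ 2 ∂(gaussianReal 0 1) := by
  have hK0 : 0 ≤ ∫ ω, X n ω ^ 2 ∂P := integral_nonneg fun _ => sq_nonneg _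
  have i1 := h.integrable_mul_comp_errors ((h.adapted n).pow_const 2) hX.integrable_sq
    (f := fun z => z ^ 2) (by fun_prop) (integrable_pow_stdGaussian 2)
  have i2 := h.integrable_comp_errors n (f := fun z => (z ^ 2 - 1) ^ 2)
    integrable_sq_sub_one_sq_stdGaussian
  have hprod : ∫ ω, X n ω ^ 2 * e n ω ^ 2 ∂P = ∫ ω, X n ω ^ 2 ∂P := by
    have := ((h.indepFun (h.adapted n)).comp (measurable_id.pow_const 2)
      (measurable_id.pow_const 2)).integral_fun_mul_eq_mul_integral
      ((h.measurable n).pow_const 2).aestronglyMeasurable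
      ((h.measurable_errors n).pow_const 2).aestronglyMeasurable
    simp only [Function.comp_def, id] at this
    rw [this, h.integral_comp_errors n (f := fun z => z ^ 2) (by fun_prop),
      integral_sq_stdGaussian, mul_one]
  have hαA : α n ^ 2 ≤ A ^ 2 :=
    sq_le_sq' (by linarith [neg_abs_le (α n)]) ((le_abs_self _).trans hα)
  calc ∫ ω, sqInnovation X e α s n ω ^ 2 ∂P
      ≤ ∫ ω, (8 * α n ^ 2 * s ^ 2 * (X n ω ^ 2 * e n ω ^ 2)
          + 2 * s ^ 4 * (e n ω ^ 2 - 1) ^ 2) ∂P := by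
        refine integral_mono (h.memLp_sqInnovation α s hX).integrable_sq
          ((i1.const_mul _).add (i2.const_mul _)) fun ω => ?_
        simp only [sqInnovation]
        nlinarith [sq_nonneg (2 * α n * s * (X n ω * e n ω) - s ^ 2 * (e n ω ^ 2 - 1))]
    _ = 8 * α n ^ 2 * s ^ 2 * ∫ ω, X n ω ^ 2 ∂P
          + 2 * s ^ 4 * ∫ z, (z ^ 2 - 1) ^ 2 ∂(gaussianReal 0 1) := by
        rw [integral_add (i1.const_mul _) (i2.const_mul _), integral_const_mul, integral_const_mul,
          hprod, h.integral_comp_errors n (f := fun z => (z ^ 2 - 1) ^ 2) (by fun_prop)]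
    _ ≤ _ := by gcongr

theorem measurable_sum_sqInnovation (h : HasGaussianErrors P G X e) (α : ℕ → ℝ) (s : ℝ) (N : ℕ) :
    Measurable[G N] (fun ω => ∑ n ∈ Finset.range N, sqInnovation X e α s n ω) := by
  refine Finset.measurable_fun_sum _ fun n hn => ?_
  have hn : n < N := Finset.mem_range.1 hn
  have h1 : Measurable[G N] (X n) := (h.adapted n).mono (G.mono hn.le) le_rfl
  have h2 : Measurable[G N] (e n) := (h.errors_measurable n).mono (G.mono hn) le_rfl
  exact ((h1.mul h2).const_mul _).add (((h2.pow_const 2).sub_const 1).const_mul _)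

/-- The innovations of the squared process are orthogonal, so that the second moment of their sum
grows at most linearly. -/
theorem integral_sum_sqInnovation_sq_le [IsProbabilityMeasure P] (h : HasGaussianErrors P G X e)
    {α : ℕ → ℝ} {s D : ℝ} (hX : ∀ n, MemLp (X n) 2 P)
    (hD : ∀ n, ∫ ω, sqInnovation X e α s n ω ^ 2 ∂P ≤ D) (N : ℕ) :
    ∫ ω, (∑ n ∈ Finset.range N, sqInnovation X e α s n ω) ^ 2 ∂P ≤ N * D := by
  induction N with
  | zero => simp
  | succ N ih =>
    set S : Ω → ℝ := fun ω => ∑ n ∈ Finset.range N, sqInnovation X e α s n ω with hS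
    have hSm : Measurable[G N] S := h.measurable_sum_sqInnovation α s N
    have hS2 : MemLp S 2 P := memLp_finsetSum _ fun n _ => h.memLp_sqInnovation α s (hX n)
    have hd2 : MemLp (sqInnovation X e α s N) 2 P := h.memLp_sqInnovation α s (hX N)
    -- Both terms of the new innovation are products of a function of the past with a centred
    -- function of the error.
    have hcross : ∫ ω, S ω * sqInnovation X e α s N ω ∂P = 0 := by
      have j1 := h.integrable_mul_comp_errors (hSm.mul (h.adapted N)) (hS2.integrable_mul (hX N))
        measurable_id (by simpa [Function.id_def] using integrable_pow_stdGaussian 1)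
      have j2 := h.integrable_mul_comp_errors hSm (hS2.integrable one_le_two)
        (f := fun z => z ^ 2 - 1) (by fun_prop)
        ((integrable_pow_stdGaussian 2).sub (integrable_const 1))
      have z1 := h.integral_mul_comp_errors_eq_zero (hSm.mul (h.adapted N)) measurable_id
        (by simp)
      have z2 := h.integral_mul_comp_errors_eq_zero hSm (f := fun z => z ^ 2 - 1) (by fun_prop)
        (by rw [integral_sub (integrable_pow_stdGaussian 2) (integrable_const 1),
              integral_sq_stdGaussian]; simp)
      have : ∀ ω, S ω * sqInnovation X e α s N ω
          = 2 * α N * s * ((S * X N) ω * id (e N ω)) + s ^ 2 * (S ω * (e N ω ^ 2 - 1)) := by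
        intro ω
        simp only [sqInnovation, Pi.mul_apply, id]
        ring
      simp_rw [this]
      rw [integral_add (j1.const_mul _) (j2.const_mul _), integral_const_mul, integral_const_mul,
        z1, z2, mul_zero, mul_zero, add_zero]
    have hsplit : ∀ ω, (∑ n ∈ Finset.range (N + 1), sqInnovation X e α s n ω) ^ 2
        = S ω ^ 2 + 2 * (S ω * sqInnovation X e α s N ω) + sqInnovation X e α s N ω ^ 2 := by
      intro ω
      rw [Finset.sum_range_succ]
      ring
    simp_rw [hsplit]
    have k1 : Integrable (fun ω => 2 * (S ω * sqInnovation X e α s N ω)) P :=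
      (hS2.integrable_mul hd2).const_mul 2
    have k2 : Integrable (fun ω => S ω ^ 2 + 2 * (S ω * sqInnovation X e α s N ω)) P :=
      hS2.integrable_sq.add k1
    rw [integral_add k2 hd2.integrable_sq,
      integral_add hS2.integrable_sq k1, integral_const_mul, hcross]
    push_cast
    linarith [hD N]

/-- Summing `X_{n+1}² = α_n² X_n² + s² + d_n` over `n`, where `d` is the innovation of the squared
process. -/
theorem one_sub_sq_mul_sum_sq {α : ℕ → ℝ} {s a : ℝ}
    (hrec : ∀ n ω, X (n + 1) ω = α n * X n ω + s * e n ω) (N : ℕ) (ω : Ω) :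
    (1 - a ^ 2) * ∑ n ∈ Finset.range N, X n ω ^ 2
      = X 0 ω ^ 2 - X N ω ^ 2 + N * s ^ 2 + ∑ n ∈ Finset.range N, (α n ^ 2 - a ^ 2) * X n ω ^ 2
        + ∑ n ∈ Finset.range N, sqInnovation X e α s n ω := by
  induction N with
  | zero => simp
  | succ N ih =>
    simp only [Finset.sum_range_succ, mul_add, ih, sqInnovation, hrec N ω]
    push_cast
    ring

/-- Law of large numbers in `L¹` for an autoregressive process whose coefficients converge to a
limit in `(-1, 1)`. The sum of `N` squares is divided by `N + 1`, the size of the sample in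
which these are the lagged observations. -/
theorem tendsto_integral_abs_mean_sq_sub [IsProbabilityMeasure P] (h : HasGaussianErrors P G X e)
    {α : ℕ → ℝ} {s a v K : ℝ} (hrec : ∀ n ω, X (n + 1) ω = α n * X n ω + s * e n ω)
    (hα : Tendsto α atTop (nhds a)) (ha : a ^ 2 < 1) (hv : (1 - a ^ 2) * v = s ^ 2)
    (hX : ∀ n, MemLp (X n) 2 P) (hK : ∀ n, ∫ ω, X n ω ^ 2 ∂P ≤ K) :
    Tendsto (fun N : ℕ => ∫ ω, |(∑ n ∈ Finset.range N, X n ω ^ 2) / (N + 1) - v| ∂P) atTop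
      (nhds 0) := by
  obtain ⟨A, hA⟩ : ∃ A, ∀ n, |α n| ≤ A := by
    obtain ⟨A, hA⟩ := hα.abs.bddAbove_range
    exact ⟨A, fun n => hA ⟨n, rfl⟩⟩
  set D := 8 * A ^ 2 * s ^ 2 * K + 2 * s ^ 4 * ∫ z, (z ^ 2 - 1) ^ 2 ∂(gaussianReal 0 1) with hDdef
  have hD : ∀ n, ∫ ω, sqInnovation X e α s n ω ^ 2 ∂P ≤ D := fun n =>
    h.integral_sqInnovation_sq_le (hX n) (hA n) (hK n)
  have hD0 : 0 ≤ D := (integral_nonneg fun _ => sq_nonneg _).trans (hD 0)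
  have ha' : 0 < 1 - a ^ 2 := by linarith
  set S : ℕ → Ω → ℝ := fun N ω => ∑ n ∈ Finset.range N, sqInnovation X e α s n ω with hS
  have hS2 : ∀ N, MemLp (S N) 2 P := fun N =>
    memLp_finsetSum _ fun n _ => h.memLp_sqInnovation α s (hX n)
  set R : ℕ → Ω → ℝ := fun N ω => ∑ n ∈ Finset.range N, |α n ^ 2 - a ^ 2| * X n ω ^ 2 with hR
  have hRi : ∀ N, Integrable (R N) P := fun N =>
    integrable_finsetSum _ fun n _ => (hX n).integrable_sq.const_mul _
  have hQi : ∀ N : ℕ, Integrable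
      (fun ω => |(∑ n ∈ Finset.range N, X n ω ^ 2) / ((N : ℝ) + 1) - v|) P := fun N =>
    (((integrable_finsetSum _ fun n _ => (hX n).integrable_sq).div_const _).sub
      (integrable_const v)).abs
  have hbound : ∀ N : ℕ, ∫ ω, |(∑ n ∈ Finset.range N, X n ω ^ 2) / (N + 1) - v| ∂P
      ≤ ((2 * K + s ^ 2) * (1 / ((N : ℝ) + 1))
          + K * ((∑ n ∈ Finset.range N, |α n ^ 2 - a ^ 2|) / (N + 1))
          + (1 + D) * (√(N + 1))⁻¹) / (1 - a ^ 2) := by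
    intro N
    have hN : (0 : ℝ) < N + 1 := by positivity
    set c := √((N : ℝ) + 1) with hc
    have hc0 : 0 < c := Real.sqrt_pos.2 hN
    have hc2 : c ^ 2 = N + 1 := Real.sq_sqrt hN.le
    have hi0 : Integrable (fun ω => X 0 ω ^ 2 + X N ω ^ 2) P :=
      (hX 0).integrable_sq.add (hX N).integrable_sq
    have hi1 : Integrable (fun ω => X 0 ω ^ 2 + X N ω ^ 2 + s ^ 2) P :=
      hi0.add (integrable_const _)
    have hi1R : Integrable (fun ω => X 0 ω ^ 2 + X N ω ^ 2 + s ^ 2 + R N ω) P := hi1.add (hRi N)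
    have hi2 : Integrable (fun ω => c + S N ω ^ 2 / c) P :=
      (integrable_const c).add ((hS2 N).integrable_sq.div_const c)
    -- The centred sum is bounded pointwise, with the inequality `|S| ≤ c + S² / c` for the
    -- innovations.
    have hpt : ∀ ω, |(∑ n ∈ Finset.range N, X n ω ^ 2) / ((N : ℝ) + 1) - v|
        ≤ (1 / ((1 - a ^ 2) * (N + 1)))
          * ((X 0 ω ^ 2 + X N ω ^ 2 + s ^ 2) + R N ω + (c + S N ω ^ 2 / c)) := by
      intro ω
      have e1 := one_sub_sq_mul_sum_sq (a := a) hrec N ω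
      have e2 : (∑ n ∈ Finset.range N, X n ω ^ 2) / ((N : ℝ) + 1) - v
          = (1 / ((1 - a ^ 2) * (N + 1))) * (X 0 ω ^ 2 - X N ω ^ 2 - s ^ 2
            + ∑ n ∈ Finset.range N, (α n ^ 2 - a ^ 2) * X n ω ^ 2 + S N ω) := by
        field_simp
        linear_combination e1 - (N + 1) * hv
      rw [e2, abs_mul, abs_of_pos (by positivity)]
      refine mul_le_mul_of_nonneg_left ?_ (by positivity)
      have b1 : |∑ n ∈ Finset.range N, (α n ^ 2 - a ^ 2) * X n ω ^ 2| ≤ R N ω := by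
        refine (Finset.abs_sum_le_sum_abs _ _).trans (Finset.sum_le_sum fun n _ => ?_)
        rw [abs_mul, abs_of_nonneg (sq_nonneg (X n ω))]
      have b2 : |S N ω| ≤ c + S N ω ^ 2 / c := by
        rw [← sub_nonneg]
        have : c + S N ω ^ 2 / c - |S N ω| = (c ^ 2 + |S N ω| ^ 2 - c * |S N ω|) / c := by
          rw [sq_abs]; field_simp
        rw [this]
        refine div_nonneg ?_ hc0.le
        nlinarith [sq_nonneg (c - |S N ω|), sq_nonneg c, sq_nonneg (|S N ω|)]
      have b3 : |X 0 ω ^ 2 - X N ω ^ 2 - s ^ 2| ≤ X 0 ω ^ 2 + X N ω ^ 2 + s ^ 2 := by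
        rw [abs_le]
        constructor <;> nlinarith [sq_nonneg (X 0 ω), sq_nonneg (X N ω), sq_nonneg s]
      refine (abs_add_le _ _).trans (add_le_add ((abs_add_le _ _).trans (add_le_add b3 b1)) b2)
    have hi3 : Integrable (fun ω => (1 / ((1 - a ^ 2) * ((N : ℝ) + 1)))
        * ((X 0 ω ^ 2 + X N ω ^ 2 + s ^ 2) + R N ω + (c + S N ω ^ 2 / c))) P :=
      (hi1R.add hi2).const_mul _
    refine (integral_mono (hQi N) hi3 hpt).trans ?_
    have eS : ∫ ω, (c + S N ω ^ 2 / c) ∂P ≤ c * (1 + D) := by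
      rw [integral_add (integrable_const c) ((hS2 N).integrable_sq.div_const c), integral_div]
      simp only [integral_const, probReal_univ, one_smul]
      have := h.integral_sum_sqInnovation_sq_le hX hD N
      have h2 : (∫ ω, S N ω ^ 2 ∂P) / c ≤ c * D := by
        rw [div_le_iff₀ hc0]
        nlinarith
      linarith
    have eR : ∫ ω, R N ω ∂P ≤ K * ∑ n ∈ Finset.range N, |α n ^ 2 - a ^ 2| := by
      rw [integral_finsetSum _ fun n _ => (hX n).integrable_sq.const_mul _, Finset.mul_sum]
      refine Finset.sum_le_sum fun n _ => ?_
      rw [integral_const_mul, mul_comm]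
      exact mul_le_mul_of_nonneg_right (hK n) (abs_nonneg _)
    have e0 : ∫ ω, (X 0 ω ^ 2 + X N ω ^ 2 + s ^ 2) ∂P ≤ 2 * K + s ^ 2 := by
      rw [integral_add hi0 (integrable_const _),
        integral_add (hX 0).integrable_sq (hX N).integrable_sq]
      simp only [integral_const, probReal_univ, one_smul]
      linarith [hK 0, hK N]
    rw [integral_const_mul, integral_add hi1R hi2, integral_add hi1 (hRi N)]
    calc _ ≤ (1 / ((1 - a ^ 2) * (N + 1))) * ((2 * K + s ^ 2)
          + K * ∑ n ∈ Finset.range N, |α n ^ 2 - a ^ 2| + c * (1 + D)) := by gcongr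
      _ = _ := by
        rw [← hc2]
        field_simp
  refine squeeze_zero (fun N => integral_nonneg fun _ => abs_nonneg _) hbound ?_
  have t1 : Tendsto (fun N : ℕ => 1 / ((N : ℝ) + 1)) atTop (nhds 0) :=
    tendsto_one_div_add_atTop_nhds_zero_nat
  have t2 : Tendsto (fun N : ℕ => (∑ n ∈ Finset.range N, |α n ^ 2 - a ^ 2|) / ((N : ℝ) + 1)) atTop
      (nhds 0) := by
    have hz : Tendsto (fun n => |α n ^ 2 - a ^ 2|) atTop (nhds 0) := by
      have := ((hα.pow 2).sub_const (a ^ 2)).abs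
      rwa [sub_self, abs_zero] at this
    refine squeeze_zero (fun N => by positivity) (fun N => ?_) hz.cesaro
    rcases Nat.eq_zero_or_pos N with rfl | hN
    · simp
    · rw [div_eq_inv_mul]
      have : (0 : ℝ) < N := by exact_mod_cast hN
      gcongr
      linarith
  have t3 : Tendsto (fun N : ℕ => (√((N : ℝ) + 1))⁻¹) atTop (nhds 0) :=
    tendsto_inv_atTop_zero.comp (Real.tendsto_sqrt_atTop.comp
      (tendsto_atTop_add_const_right _ _ tendsto_natCast_atTop_atTop))
  simpa using (((t1.const_mul (2 * K + s ^ 2)).add (t2.const_mul K)).add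
    (t3.const_mul (1 + D))).div_const (1 - a ^ 2)

end HasGaussianErrors

/-! ### Central limit theorem for sums with Gaussian errors -/

theorem abs_exp_sub_exp_le {x y M : ℝ} (hx : x ≤ M) (hy : y ≤ M) :
    |Real.exp x - Real.exp y| ≤ Real.exp M * |x - y| := by
  wlog h : y ≤ x generalizing x y
  · rw [abs_sub_comm, abs_sub_comm x]
    exact this hy hx (le_of_not_ge h)
  rw [abs_of_nonneg (sub_nonneg.2 (Real.exp_le_exp.2 h)), abs_of_nonneg (sub_nonneg.2 h)]
  have h1 : Real.exp y = Real.exp x * Real.exp (y - x) := by rw [← Real.exp_add]; ring_nf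
  have h2 : y - x + 1 ≤ Real.exp (y - x) := Real.add_one_le_exp _
  have h3 : Real.exp x ≤ Real.exp M := Real.exp_le_exp.2 hx
  calc Real.exp x - Real.exp y = Real.exp x * (1 - Real.exp (y - x)) := by rw [h1]; ring
    _ ≤ Real.exp x * (x - y) := by
      refine mul_le_mul_of_nonneg_left ?_ (Real.exp_nonneg x)
      linarith
    _ ≤ Real.exp M * (x - y) := mul_le_mul_of_nonneg_right h3 (sub_nonneg.2 h)

/-- The sequence `x`, set to zero from the first index at which its sum of squares exceeds `C`. -/
noncomputable def truncation (C : ℝ) (x : ℕ → ℝ) (n : ℕ) : ℝ :=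
  if ∑ i ∈ Finset.range (n + 1), x i ^ 2 ≤ C then x n else 0

theorem sum_truncation_sq_le {C : ℝ} (hC : 0 ≤ C) (x : ℕ → ℝ) (N : ℕ) :
    ∑ i ∈ Finset.range N, truncation C x i ^ 2 ≤ C := by
  have hle : ∀ n, truncation C x n ^ 2 ≤ x n ^ 2 := by
    intro n
    unfold truncation
    split_ifs
    · exact le_rfl
    · simpa using sq_nonneg (x n)
  induction N with
  | zero => simpa using hC
  | succ N ih =>
    by_cases h : ∑ i ∈ Finset.range (N + 1), x i ^ 2 ≤ C
    · exact (Finset.sum_le_sum fun i _ => hle i).trans h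
    · rw [Finset.sum_range_succ, truncation, if_neg h]
      simpa using ih

theorem truncation_eq_self {C : ℝ} {x : ℕ → ℝ} {N n : ℕ} (hn : n < N)
    (h : ∑ i ∈ Finset.range N, x i ^ 2 ≤ C) : truncation C x n = x n := by
  refine if_pos (le_trans ?_ h)
  exact Finset.sum_le_sum_of_subset_of_nonneg (Finset.range_mono hn) fun i _ _ => sq_nonneg _

/-- The complex exponential martingale `exp (i u ∑ yₙ zₙ + u² / 2 ∑ yₙ²)`, for the truncation `y` of
the sequence `x` and errors `z`. -/
noncomputable def expMartingale (C u : ℝ) (x z : ℕ → ℝ) (N : ℕ) : ℂ :=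
  Complex.exp (((u * ∑ n ∈ Finset.range N, truncation C x n * z n : ℝ) : ℂ) * Complex.I
    + ((u ^ 2 / 2 * ∑ n ∈ Finset.range N, truncation C x n ^ 2 : ℝ) : ℂ))

theorem norm_exp_ofReal_mul_I_add (a b : ℝ) :
    ‖Complex.exp ((a : ℂ) * Complex.I + (b : ℂ))‖ = Real.exp b := by
  simp [Complex.norm_exp]

theorem norm_expMartingale_le {C : ℝ} (hC : 0 ≤ C) (u : ℝ) (x z : ℕ → ℝ) (N : ℕ) :
    ‖expMartingale C u x z N‖ ≤ Real.exp (u ^ 2 / 2 * C) := by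
  rw [expMartingale, norm_exp_ofReal_mul_I_add]
  exact Real.exp_le_exp.2 (mul_le_mul_of_nonneg_left (sum_truncation_sq_le hC x N) (by positivity))

theorem expMartingale_succ (C u : ℝ) (x z : ℕ → ℝ) (N : ℕ) :
    expMartingale C u x z (N + 1) = expMartingale C u x z N
      * Complex.exp (((u * truncation C x N * z N : ℝ) : ℂ) * Complex.I
          + ((u ^ 2 / 2 * truncation C x N ^ 2 : ℝ) : ℂ)) := by
  rw [expMartingale, expMartingale, ← Complex.exp_add, Finset.sum_range_succ,
    Finset.sum_range_succ]
  congr 1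
  push_cast
  ring

theorem integral_exp_stdGaussian (w : ℝ) :
    ∫ z : ℝ, Complex.exp (((w * z : ℝ) : ℂ) * Complex.I) ∂(gaussianReal 0 1)
      = Complex.exp (-((w ^ 2 / 2 : ℝ) : ℂ)) := by
  have h := charFun_gaussianReal (μ := 0) (v := 1) w
  rw [charFun_apply_real] at h
  simp only [Complex.ofReal_mul]
  rw [h]
  congr 1
  push_cast
  ring

/-- While the sum of squares of `x` has not exceeded `v + 1`, the exponential martingale differs
from `exp (i u ∑ xₙ zₙ + u² v / 2)` by a multiple of `|∑ xₙ² - v|`; afterwards `|∑ xₙ² - v| ≥ 1`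
and both are bounded. -/
theorem norm_exp_mul_sub_expMartingale_le {v : ℝ} (hv : 0 ≤ v) (u : ℝ) (x z : ℕ → ℝ) (N : ℕ) :
    ‖Complex.exp (((u * ∑ n ∈ Finset.range N, x n * z n : ℝ) : ℂ) * Complex.I
          + ((u ^ 2 / 2 * v : ℝ) : ℂ)) - expMartingale (v + 1) u x z N‖
      ≤ Real.exp (u ^ 2 / 2 * (v + 1)) * (u ^ 2 / 2 + 2)
        * |∑ n ∈ Finset.range N, x n ^ 2 - v| := by
  set Q := ∑ n ∈ Finset.range N, x n ^ 2 with hQ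
  have hu : 0 ≤ u ^ 2 / 2 := by positivity
  have hE := Real.exp_pos (u ^ 2 / 2 * (v + 1))
  have hvM : u ^ 2 / 2 * v ≤ u ^ 2 / 2 * (v + 1) := by nlinarith
  by_cases h : Q ≤ v + 1
  · have e1 : ∑ n ∈ Finset.range N, truncation (v + 1) x n * z n
        = ∑ n ∈ Finset.range N, x n * z n :=
      Finset.sum_congr rfl fun n hn => by rw [truncation_eq_self (Finset.mem_range.1 hn) h]
    have e2 : ∑ n ∈ Finset.range N, truncation (v + 1) x n ^ 2 = Q :=
      Finset.sum_congr rfl fun n hn => by rw [truncation_eq_self (Finset.mem_range.1 hn) h]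
    rw [expMartingale, e1, e2, Complex.exp_add, Complex.exp_add, ← mul_sub, norm_mul,
      Complex.norm_exp_ofReal_mul_I, one_mul, ← Complex.ofReal_exp, ← Complex.ofReal_exp,
      ← Complex.ofReal_sub, Complex.norm_real, Real.norm_eq_abs]
    refine (abs_exp_sub_exp_le hvM (mul_le_mul_of_nonneg_left h hu)).trans ?_
    rw [← mul_sub, abs_mul, abs_of_nonneg hu, abs_sub_comm v, mul_assoc]
    refine mul_le_mul_of_nonneg_left ?_ hE.le
    nlinarith [abs_nonneg (Q - v)]
  · have h1 : 1 ≤ |Q - v| := le_trans (by linarith) (le_abs_self _)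
    refine (norm_sub_le _ _).trans ?_
    rw [norm_exp_ofReal_mul_I_add]
    have h2 := norm_expMartingale_le (by linarith : 0 ≤ v + 1) u x z N
    have h3 := Real.exp_le_exp.2 hvM
    have h4 : 2 ≤ (u ^ 2 / 2 + 2) * |Q - v| := by nlinarith
    rw [mul_assoc]
    nlinarith

namespace HasGaussianErrors

variable {Ω : Type*} {mΩ : MeasurableSpace Ω} {P : Measure Ω}
  {G : Filtration ℕ mΩ} {X e : ℕ → Ω → ℝ}

theorem measurable_truncation (h : HasGaussianErrors P G X e) (C r : ℝ) {n N : ℕ} (hn : n ≤ N) :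
    Measurable[G N] (fun ω => truncation C (fun i => r * X i ω) n) := by
  have hX : ∀ i ≤ n, Measurable[G N] (fun ω => r * X i ω) := fun i hi =>
    ((h.adapted i).mono (G.mono (hi.trans hn)) le_rfl).const_mul r
  refine Measurable.ite ?_ (hX n le_rfl) measurable_const
  exact measurableSet_le (Finset.measurable_fun_sum _ fun i hi =>
    (hX i (Nat.lt_succ_iff.1 (Finset.mem_range.1 hi))).pow_const 2) measurable_const

theorem measurable_expMartingale (h : HasGaussianErrors P G X e) (C u r : ℝ) (N : ℕ) :
    Measurable[G N]
      (fun ω => expMartingale C u (fun i => r * X i ω) (fun i => e i ω) N) := by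
  have hy : ∀ n ∈ Finset.range N,
      Measurable[G N] (fun ω => truncation C (fun i => r * X i ω) n) := fun n hn =>
    h.measurable_truncation C r (Finset.mem_range.1 hn).le
  have he : ∀ n ∈ Finset.range N, Measurable[G N] (e n) := fun n hn =>
    (h.errors_measurable n).mono (G.mono (Finset.mem_range.1 hn)) le_rfl
  have h1 : Measurable[G N] (fun ω => u * ∑ n ∈ Finset.range N,
      truncation C (fun i => r * X i ω) n * e n ω) :=
    (Finset.measurable_fun_sum _ fun n hn => (hy n hn).mul (he n hn)).const_mul u
  have h2 : Measurable[G N] (fun ω => u ^ 2 / 2 * ∑ n ∈ Finset.range N,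
      truncation C (fun i => r * X i ω) n ^ 2) :=
    (Finset.measurable_fun_sum _ fun n hn => (hy n hn).pow_const 2).const_mul _
  exact Complex.measurable_exp.comp
    (((Complex.measurable_ofReal.comp h1).mul_const _).add (Complex.measurable_ofReal.comp h2))

/-- Given the past, each factor of the exponential martingale integrates to one over the Gaussian
error. -/
theorem integral_expMartingale [IsProbabilityMeasure P] (h : HasGaussianErrors P G X e) {C : ℝ}
    (hC : 0 ≤ C) (u r : ℝ) (N : ℕ) :
    ∫ ω, expMartingale C u (fun i => r * X i ω) (fun i => e i ω) N ∂P = 1 := by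
  induction N with
  | zero => simp [expMartingale]
  | succ N ih =>
    set M : Ω → ℂ := fun ω => expMartingale C u (fun i => r * X i ω) (fun i => e i ω) N with hM
    set y : Ω → ℝ := fun ω => truncation C (fun i => r * X i ω) N with hy
    have hMy : Measurable[G N] (fun ω => (M ω, y ω)) :=
      (h.measurable_expMartingale C u r N).prodMk (h.measurable_truncation C r le_rfl)
    have hMy' : Measurable (fun ω => (M ω, y ω)) := hMy.mono (G.le N) le_rfl
    have hem := h.measurable_errors N
    have hpair : Measurable (fun ω => ((M ω, y ω), e N ω)) := hMy'.prodMk hem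
    let F : (ℂ × ℝ) × ℝ → ℂ := fun p => p.1.1 * Complex.exp (((u * p.1.2 * p.2 : ℝ) : ℂ) * Complex.I
      + ((u ^ 2 / 2 * p.1.2 ^ 2 : ℝ) : ℂ))
    have hF : Measurable F := by fun_prop
    have hsucc : ∀ ω, expMartingale C u (fun i => r * X i ω) (fun i => e i ω) (N + 1)
        = F ((M ω, y ω), e N ω) := fun ω => expMartingale_succ _ _ _ _ _
    -- The error is independent of the past, so the expectation is an iterated integral.
    have hmap : P.map (fun ω => ((M ω, y ω), e N ω))
        = (P.map fun ω => (M ω, y ω)).prod (gaussianReal 0 1) := by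
      rw [(h.indepFun hMy).map_prod_eq_prod_map_map hMy'.aemeasurable hem.aemeasurable,
        (h.errors_law N).map_eq]
    have hint : Integrable F ((P.map fun ω => (M ω, y ω)).prod (gaussianReal 0 1)) := by
      rw [← hmap, integrable_map_measure hF.aestronglyMeasurable hpair.aemeasurable]
      refine Integrable.of_bound (hF.comp hpair).aestronglyMeasurable (Real.exp (u ^ 2 / 2 * C))
        (ae_of_all _ fun ω => ?_)
      rw [Function.comp_apply, ← hsucc]
      exact norm_expMartingale_le hC _ _ _ _
    have hP : IsProbabilityMeasure (P.map fun ω => (M ω, y ω)) :=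
      Measure.isProbabilityMeasure_map hMy'.aemeasurable
    have hinner : ∀ p : ℂ × ℝ, ∫ z, F (p, z) ∂(gaussianReal 0 1) = p.1 := by
      intro p
      simp only [F, Complex.exp_add]
      rw [integral_const_mul, integral_mul_const, integral_exp_stdGaussian, ← Complex.exp_add]
      have : -(((u * p.2) ^ 2 / 2 : ℝ) : ℂ) + ((u ^ 2 / 2 * p.2 ^ 2 : ℝ) : ℂ) = 0 := by
        push_cast
        ring
      rw [this, Complex.exp_zero, mul_one]
    simp_rw [hsucc]
    rw [← integral_map (φ := fun ω => ((M ω, y ω), e N ω)) hpair.aemeasurable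
      hF.aestronglyMeasurable, hmap, integral_prod _ hint]
    simp_rw [hinner]
    rw [integral_map hMy'.aemeasurable (by fun_prop)]
    exact ih

/-- Central limit theorem: a sum of regressors times Gaussian errors is asymptotically normal when
the sum of the squared regressors converges in `L¹` to a constant. -/
theorem tendstoInDistribution_sum_mul_errors [IsProbabilityMeasure P]
    (h : HasGaussianErrors P G X e) {r : ℕ → ℝ} {v : ℝ} (hv : 0 ≤ v)
    (hX : ∀ n, MemLp (X n) 2 P)
    (hQ : Tendsto (fun N => ∫ ω, |∑ n ∈ Finset.range N, (r N * X n ω) ^ 2 - v| ∂P) atTop (nhds 0))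
    {Ω' : Type*} [MeasurableSpace Ω'] {P' : Measure Ω'} [IsProbabilityMeasure P'] {Z : Ω' → ℝ}
    (hZ : HasLaw Z (gaussianReal 0 (Real.toNNReal v)) P') :
    TendstoInDistribution (fun N ω => ∑ n ∈ Finset.range N, r N * X n ω * e n ω) atTop Z
      (fun _ => P) P' := by
  have hXm := h.measurable
  have hem := h.measurable_errors
  have hSm : ∀ N, Measurable (fun ω => ∑ n ∈ Finset.range N, r N * X n ω * e n ω) := fun N =>
    Finset.measurable_fun_sum _ fun n _ => ((hXm n).const_mul _).mul (hem n)
  refine ⟨fun N => (hSm N).aemeasurable, hZ.aemeasurable, ?_⟩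
  refine ProbabilityMeasure.tendsto_of_tendsto_charFun fun u => ?_
  simp only [ProbabilityMeasure.coe_mk, hZ.map_eq, charFun_gaussianReal]
  set L := Real.exp (u ^ 2 / 2 * (v + 1)) * (u ^ 2 / 2 + 2) with hL
  have hc : ∀ N, charFun (P.map fun ω => ∑ n ∈ Finset.range N, r N * X n ω * e n ω) u
      = ∫ ω, Complex.exp (((u * ∑ n ∈ Finset.range N, r N * X n ω * e n ω : ℝ) : ℂ)
          * Complex.I) ∂P := by
    intro N
    rw [charFun_apply_real, integral_map (hSm N).aemeasurable (by fun_prop)]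
    simp only [Complex.ofReal_mul]
  have hbound : ∀ N, ‖charFun (P.map fun ω => ∑ n ∈ Finset.range N, r N * X n ω * e n ω) u
      * Complex.exp ((u ^ 2 / 2 * v : ℝ) : ℂ) - 1‖
      ≤ L * ∫ ω, |∑ n ∈ Finset.range N, (r N * X n ω) ^ 2 - v| ∂P := by
    intro N
    have hMi : Integrable (fun ω =>
        expMartingale (v + 1) u (fun i => r N * X i ω) (fun i => e i ω) N) P :=
      Integrable.of_bound
        ((h.measurable_expMartingale (v + 1) u (r N) N).mono (G.le N) le_rfl).aestronglyMeasurable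
        _ (ae_of_all _ fun ω => norm_expMartingale_le (by linarith) u _ _ N)
    have hEi : Integrable (fun ω =>
        Complex.exp (((u * ∑ n ∈ Finset.range N, r N * X n ω * e n ω : ℝ) : ℂ) * Complex.I
          + ((u ^ 2 / 2 * v : ℝ) : ℂ))) P := by
      refine Integrable.of_bound ?_ (Real.exp (u ^ 2 / 2 * v)) (ae_of_all _ fun ω => ?_)
      · exact (Complex.measurable_exp.comp (((Complex.measurable_ofReal.comp
          ((hSm N).const_mul u)).mul_const _).add_const _)).aestronglyMeasurable
      · rw [norm_exp_ofReal_mul_I_add]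
    have hQi : Integrable (fun ω => |∑ n ∈ Finset.range N, (r N * X n ω) ^ 2 - v|) P :=
      ((integrable_finsetSum _ fun n _ => ((hX n).const_mul (r N)).integrable_sq).sub
        (integrable_const v)).abs
    rw [hc, ← integral_mul_const, ← h.integral_expMartingale (by linarith : 0 ≤ v + 1) u (r N) N]
    simp_rw [← Complex.exp_add]
    rw [← integral_sub hEi hMi, ← integral_const_mul]
    refine (norm_integral_le_integral_norm _).trans
      (integral_mono (hEi.sub hMi).norm (hQi.const_mul L) fun ω => ?_)
    exact norm_exp_mul_sub_expMartingale_le hv u (fun i => r N * X i ω) (fun i => e i ω) N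
  have hlim : Tendsto (fun N => charFun
      (P.map fun ω => ∑ n ∈ Finset.range N, r N * X n ω * e n ω) u
      * Complex.exp ((u ^ 2 / 2 * v : ℝ) : ℂ)) atTop (nhds 1) := by
    rw [tendsto_iff_norm_sub_tendsto_zero]
    exact squeeze_zero (fun _ => norm_nonneg _) hbound (by simpa using hQ.const_mul L)
  have := hlim.mul_const (Complex.exp (-((u ^ 2 / 2 * v : ℝ) : ℂ)))
  have hcancel : ∀ c a : ℂ, c * Complex.exp a * Complex.exp (-a) = c := fun c a => by
    rw [mul_assoc, ← Complex.exp_add, add_neg_cancel, Complex.exp_zero, mul_one]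
  simp only [hcancel, one_mul] at this
  convert this using 2
  rw [Real.coe_toNNReal v hv]
  congr 1
  push_cast
  ring

end HasGaussianErrors

section

/-! ### Asymptotic normality of the infeasible estimator -/

theorem tendstoInMeasure_comp_of_continuousAt {Ω : Type*} {mΩ : MeasurableSpace Ω}
    {P : Measure Ω} {f : ℕ → Ω → ℝ} {c : ℝ} {g : ℝ → ℝ} (hg : ContinuousAt g c)
    (hf : TendstoInMeasure P f atTop fun _ => c) :
    TendstoInMeasure P (fun n ω => g (f n ω)) atTop fun _ => g c := by
  rw [tendstoInMeasure_iff_dist] at hf ⊢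
  intro ε hε
  obtain ⟨δ, hδ, h⟩ := Metric.continuousAt_iff.1 hg ε hε
  refine tendsto_of_tendsto_of_tendsto_of_le_of_le tendsto_const_nhds (hf δ hδ)
    (fun _ => zero_le) fun n => measure_mono fun ω hω => ?_
  by_contra hlt
  exact absurd (h (not_le.1 hlt)) (not_lt.2 hω)

theorem tendstoInMeasure_of_tendsto_integral_abs_sub {Ω : Type*} {mΩ : MeasurableSpace Ω}
    {P : Measure Ω} [IsFiniteMeasure P] {f : ℕ → Ω → ℝ} {c : ℝ} (hf : ∀ n, Integrable (f n) P)
    (h : Tendsto (fun n => ∫ ω, |f n ω - c| ∂P) atTop (nhds 0)) :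
    TendstoInMeasure P f atTop fun _ => c := by
  refine tendstoInMeasure_of_tendsto_eLpNorm one_ne_zero
    (fun n => (hf n).aestronglyMeasurable) aestronglyMeasurable_const ?_
  have : ∀ n, eLpNorm (f n - fun _ => c) 1 P = ENNReal.ofReal (∫ ω, |f n ω - c| ∂P) := by
    intro n
    rw [eLpNorm_one_eq_lintegral_enorm,
      ← ofReal_integral_norm_eq_lintegral_enorm ((hf n).sub (integrable_const c))]
    rfl
  simp_rw [this]
  simpa using ENNReal.tendsto_ofReal h

theorem tendstoInDistribution_of_add {Ω Ω' : Type*} {mΩ : MeasurableSpace Ω}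
    {mΩ' : MeasurableSpace Ω'} {P : Measure Ω} [IsProbabilityMeasure P] {P' : Measure Ω'}
    [IsProbabilityMeasure P'] {f : ℕ → Ω → ℝ} {Z : Ω' → ℝ} (hf : ∀ n, AEMeasurable (f n) P) (k : ℕ)
    (h : TendstoInDistribution (fun n => f (n + k)) atTop Z (fun _ => P) P') :
    TendstoInDistribution f atTop Z (fun _ => P) P' :=
  ⟨hf, h.aemeasurable_limit, (tendsto_add_atTop_iff_nat k).1 h.tendsto⟩

theorem sum_Icc_two_succ (f : ℕ → ℝ) (N : ℕ) :
    ∑ t ∈ Finset.Icc 2 (N + 1), f t = ∑ n ∈ Finset.range N, f (n + 2) := by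
  induction N with
  | zero => simp
  | succ N ih => rw [Finset.sum_Icc_succ_top (by omega), ih, Finset.sum_range_succ]

variable {Ω : Type*} [mΩ : MeasurableSpace Ω] {P : Measure Ω} [IsProbabilityMeasure P]
  {φ ρ σ : ℝ} {Y ξ : ℕ → Ω → ℝ}

/-- The natural filtration of the process `(Y_{n+1})_n`, enlarged by `Y_0`. -/
def shiftedFiltration (Y : ℕ → Ω → ℝ) (hY : ∀ t, Measurable (Y t)) : Filtration ℕ mΩ where
  seq n := Filtration.natural Y (fun i => (hY i).stronglyMeasurable) (n + 1)
  mono' _ _ h := Filtration.mono _ (Nat.succ_le_succ h)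
  le' _ := Filtration.le _ _

theorem hasGaussianErrors_process (h : IsDIGAR1 P φ ρ σ Y ξ)
    (hM : IsMarkovProcess P Y h.measurable) :
    HasGaussianErrors P (shiftedFiltration Y h.measurable) (fun n => Y (n + 1))
      (fun n => residual φ ρ σ Y (n + 1)) := by
  have had : ∀ n, Measurable[shiftedFiltration Y h.measurable n] (Y (n + 1)) := fun n =>
    (Filtration.stronglyAdapted_natural
      (fun i => (h.measurable i).stronglyMeasurable) (n + 1)).measurable
  refine ⟨had, fun n => ?_, fun n => hasLaw_residual h n.succ_ne_zero,
    fun n => indep_residual_natural h hM n.succ_ne_zero⟩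
  have h1 := (had n).mono ((shiftedFiltration Y h.measurable).mono n.le_succ) le_rfl
  exact ((had (n + 1)).sub (h1.const_mul _)).div_const _

theorem integral_process_sq (h : IsDIGAR1 P φ ρ σ Y ξ) (t : ℕ) :
    ∫ ω, Y t ω ^ 2 ∂P = sdSeq φ ρ σ t ^ 2 := by
  have hl := hasLaw_process h t
  have hmean : ∫ ω, Y t ω ∂P = 0 := by
    rw [hl.integral_eq, integral_id_gaussianReal]
  have hv := hl.variance_eq
  rw [variance_eq_integral hl.aemeasurable, variance_id_gaussianReal,
    Real.coe_toNNReal _ (sq_nonneg _), hmean] at hv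
  simpa using hv

theorem memLp_process (h : IsDIGAR1 P φ ρ σ Y ξ) (t : ℕ) : MemLp (Y t) 2 P :=
  (hasLaw_process h t).hasGaussianLaw.memLp_two

theorem tendsto_integral_abs_mean_sq_process (h : IsDIGAR1 P φ ρ σ Y ξ)
    (hM : IsMarkovProcess P Y h.measurable) :
    Tendsto (fun N : ℕ => ∫ ω, |(∑ n ∈ Finset.range N, Y (n + 1) ω ^ 2) / (N + 1)
      - limitStdDev φ ρ σ ^ 2| ∂P) atTop (nhds 0) := by
  have hφ := h.abs_phi_lt_one
  have hρ := h.abs_rho_lt_one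
  have hσ := h.sigma_pos
  have hs := mul_pos hσ (sqrt_one_sub_sq_pos hρ)
  have hv := one_sub_slope_sq_mul_limitStdDev_sq hφ hρ hσ
  have hL := limitStdDev_pos (ρ := ρ) hφ hσ
  obtain ⟨K, hK⟩ := ((tendsto_sdSeq hφ hρ hσ).pow 2).bddAbove_range
  refine (hasGaussianErrors_process h hM).tendsto_integral_abs_mean_sq_sub
    (α := fun n => slope φ ρ σ (n + 1)) (s := σ * √(1 - ρ ^ 2)) (K := K)
    (fun n ω => process_succ hρ hσ (n + 1) ω)
    ((tendsto_add_atTop_iff_nat 1).2 (tendsto_slope hφ hρ hσ)) ?_ hv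
    (fun n => memLp_process h (n + 1)) (fun n => ?_)
  · have : 0 < (1 - (φ + ρ * σ / limitStdDev φ ρ σ) ^ 2) * limitStdDev φ ρ σ ^ 2 := by
      rw [hv]; positivity
    have := pos_of_mul_pos_left this (sq_nonneg _)
    linarith
  · rw [integral_process_sq h]
    exact hK ⟨n + 1, rfl⟩

theorem ae_process_one_ne_zero (h : IsDIGAR1 P φ ρ σ Y ξ) : ∀ᵐ ω ∂P, Y 1 ω ≠ 0 := by
  have hl := hasLaw_process h 1
  have hpos := sdSeq_succ_pos (φ := φ) h.abs_rho_lt_one h.sigma_pos 0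
  have hne : Real.toNNReal (sdSeq φ ρ σ 1 ^ 2) ≠ 0 := by
    rw [ne_eq, Real.toNNReal_eq_zero, not_le]
    exact pow_pos hpos 2
  have := nullSingletonClass_gaussianReal (μ := 0) hne
  have h0 : P.map (Y 1) {0} = 0 := by rw [hl.map_eq]; simp
  rw [Measure.map_apply (h.measurable 1) (measurableSet_singleton 0)] at h0
  rw [ae_iff]
  simp only [not_not]
  exact h0

/-- The error of the infeasible estimator is a self-normalised sum of regressors times residuals. -/
theorem infeasibleEstimator_sub_ae_eq (h : IsDIGAR1 P φ ρ σ Y ξ) {N : ℕ} (hN : N ≠ 0) :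
    ∀ᵐ ω ∂P, √((N + 1 : ℕ) : ℝ) * (infeasibleEstimator P ρ σ Y (N + 1) ω - φ)
      = (∑ n ∈ Finset.range N, 1 / √((N : ℝ) + 1) * Y (n + 1) ω * residual φ ρ σ Y (n + 1) ω)
        * (σ * √(1 - ρ ^ 2) / ((∑ n ∈ Finset.range N, Y (n + 1) ω ^ 2) / (N + 1))) := by
  filter_upwards [ae_process_one_ne_zero h] with ω hω
  have hs := mul_pos h.sigma_pos (sqrt_one_sub_sq_pos h.abs_rho_lt_one)
  rw [infeasibleEstimator, olsEstimator, sum_Icc_two_succ, sum_Icc_two_succ, sum_Icc_two_succ]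
  simp only [stdDev_eq_sdSeq h, Nat.add_succ_sub_one]
  have hB : 0 < ∑ n ∈ Finset.range N, Y (n + 1) ω ^ 2 := by
    refine lt_of_lt_of_le ?_ (Finset.single_le_sum (f := fun n => Y (n + 1) ω ^ 2)
      (fun n _ => sq_nonneg _) (Finset.mem_range.2 (Nat.pos_of_ne_zero hN)))
    have : Y 1 ω ≠ 0 := hω
    positivity
  have hnum : ∑ n ∈ Finset.range N, Y (n + 2) ω * Y (n + 1) ω
      = φ * ∑ n ∈ Finset.range N, Y (n + 1) ω ^ 2
        + ρ * σ * ∑ n ∈ Finset.range N, Y (n + 1) ω ^ 2 / sdSeq φ ρ σ (n + 1)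
        + σ * √(1 - ρ ^ 2)
          * ∑ n ∈ Finset.range N, Y (n + 1) ω * residual φ ρ σ Y (n + 1) ω := by
    rw [Finset.mul_sum, Finset.mul_sum, Finset.mul_sum, ← Finset.sum_add_distrib,
      ← Finset.sum_add_distrib]
    refine Finset.sum_congr rfl fun n _ => ?_
    rw [process_succ (φ := φ) (Y := Y) h.abs_rho_lt_one h.sigma_pos (n + 1) ω, slope]
    ring
  have hsum : ∑ n ∈ Finset.range N, 1 / √((N : ℝ) + 1) * Y (n + 1) ω * residual φ ρ σ Y (n + 1) ω
      = 1 / √((N : ℝ) + 1)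
        * ∑ n ∈ Finset.range N, Y (n + 1) ω * residual φ ρ σ Y (n + 1) ω := by
    rw [Finset.mul_sum]
    exact Finset.sum_congr rfl fun n _ => mul_assoc _ _ _
  have hN1 : (0 : ℝ) < N + 1 := by positivity
  have hr0 : 0 < √((N : ℝ) + 1) := Real.sqrt_pos.2 hN1
  have hr : √((N : ℝ) + 1) ^ 2 = N + 1 := Real.sq_sqrt hN1.le
  rw [hsum, hnum, Nat.cast_add, Nat.cast_one]
  set r := √((N : ℝ) + 1)
  rw [← hr]
  generalize ∑ n ∈ Finset.range N, Y (n + 1) ω ^ 2 = B at hB ⊢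
  generalize ∑ n ∈ Finset.range N, Y (n + 1) ω ^ 2 / sdSeq φ ρ σ (n + 1) = C
  generalize ∑ n ∈ Finset.range N, Y (n + 1) ω * residual φ ρ σ Y (n + 1) ω = M
  field_simp
  ring

theorem measurable_infeasibleEstimator {Ω : Type*} [MeasurableSpace Ω] (P : Measure Ω) (ρ σ : ℝ)
    {Y : ℕ → Ω → ℝ} (hY : ∀ t, Measurable (Y t)) (T : ℕ) :
    Measurable (infeasibleEstimator P ρ σ Y T) := by
  unfold infeasibleEstimator olsEstimator
  fun_prop

end

end DIGAR

theorem mainTheorem1 {Ω : Type*} [MeasurableSpace Ω] (P : Measure Ω) [IsProbabilityMeasure P]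
    (φ ρ σ : ℝ) (Y ξ : ℕ → Ω → ℝ) (hDIG : DIGAR.IsDIGAR1 P φ ρ σ Y ξ)
    (hMarkov : DIGAR.IsMarkovProcess P Y hDIG.measurable)
    {Ω' : Type*} [MeasurableSpace Ω'] (P' : Measure Ω') [IsProbabilityMeasure P'] (X : Ω' → ℝ)
    (hX : HasLaw X (gaussianReal 0 (Real.toNNReal (DIGAR.asymptoticStdDev φ ρ σ ^ 2))) P') :
    TendstoInDistribution
      (fun (T : ℕ) ω => √(T : ℝ) * (DIGAR.infeasibleEstimator P ρ σ Y T ω - φ))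
      atTop X (fun _ => P) P' := by
  open DIGAR in
  have hs := mul_pos hDIG.sigma_pos (sqrt_one_sub_sq_pos hDIG.abs_rho_lt_one)
  have hL : 0 < limitStdDev φ ρ σ := limitStdDev_pos hDIG.abs_phi_lt_one hDIG.sigma_pos
  have hY := hDIG.measurable
  have hη : asymptoticStdDev φ ρ σ = σ * √(1 - ρ ^ 2) / limitStdDev φ ρ σ := rfl
  set s := σ * √(1 - ρ ^ 2) with hsdef
  set L := limitStdDev φ ρ σ with hLdef
  have hG := hasGaussianErrors_process hDIG hMarkov
  have hLLN := tendsto_integral_abs_mean_sq_process hDIG hMarkov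
  rw [← hLdef] at hLLN
  -- This rescaling of `X` is the limit in law of the normalised sum of regressors times residuals.
  have hZ : HasLaw (fun ω => L ^ 2 / s * X ω) (gaussianReal 0 (Real.toNNReal (L ^ 2))) P' := by
    have := gaussianReal_const_mul hX (L ^ 2 / s)
    convert this using 2
    · simp
    · refine NNReal.eq ?_
      rw [NNReal.coe_mul, NNReal.coe_mk, Real.coe_toNNReal _ (sq_nonneg _),
        Real.coe_toNNReal _ (sq_nonneg _), hη]
      field_simp
  have hCLT : TendstoInDistribution (fun (N : ℕ) ω => ∑ n ∈ Finset.range N,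
      1 / √((N : ℝ) + 1) * Y (n + 1) ω * residual φ ρ σ Y (n + 1) ω) atTop
      (fun ω => L ^ 2 / s * X ω) (fun _ => P) P' := by
    refine hG.tendstoInDistribution_sum_mul_errors (r := fun N => 1 / √((N : ℝ) + 1))
      (sq_nonneg L) (fun n => memLp_process hDIG (n + 1)) ?_ hZ
    refine hLLN.congr fun N => ?_
    have hN1 : (0 : ℝ) ≤ N + 1 := by positivity
    simp_rw [mul_pow, div_pow, Real.sq_sqrt hN1, ← Finset.mul_sum, one_pow, one_div_mul_eq_div]
  have hQ : TendstoInMeasure P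
      (fun (N : ℕ) ω => (∑ n ∈ Finset.range N, Y (n + 1) ω ^ 2) / ((N : ℝ) + 1)) atTop
      (fun _ => L ^ 2) :=
    tendstoInMeasure_of_tendsto_integral_abs_sub
      (fun N => (integrable_finsetSum _ fun n _ =>
        (memLp_process hDIG (n + 1)).integrable_sq).div_const _) hLLN
  have hR := tendstoInMeasure_comp_of_continuousAt (g := fun q => s / q) (c := L ^ 2)
    (continuousAt_const.div continuousAt_id (by positivity)) hQ
  have hD := hCLT.continuous_comp_prodMk_of_tendstoInMeasure_const
    (g := fun p : ℝ × ℝ => p.1 * p.2) continuous_mul hR (fun N => by fun_prop)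
  have hlim : (fun ω => L ^ 2 / s * X ω * (s / L ^ 2)) = X := by
    ext ω
    field_simp
  simp only [hlim] at hD
  -- With fewer than two observations the sums are empty and the estimator is the junk value
  -- `0 / 0`.
  refine tendstoInDistribution_of_add (fun T =>
    ((measurable_infeasibleEstimator P ρ σ hY T).sub_const φ |>.const_mul _).aemeasurable) 2 ?_
  refine TendstoInDistribution.congr
    (fun N => (infeasibleEstimator_sub_ae_eq hDIG N.succ_ne_zero).mono fun ω hω => hω.symm)
    EventuallyEq.rfl ?_
  exact ⟨fun N => hD.forall_aemeasurable (N + 1), hD.aemeasurable_limit,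
    hD.tendsto.comp (tendsto_add_atTop_nat 1)⟩
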